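/- Let $\Gamma$ be a discrete abelian group (of any cardinality). A mean on $\ell^\infty(\Gamma)$ (bounded complex functions) is a linear functional $m:\ell^\infty(\Gamma)\to\mathbb C$ with $m(1)=1$ and $m(f)\ge 0$ whenever $f\ge 0$; write $m(A):=m(1_A)$ for $A\subseteq\Gamma$, and $A\subset_m B$ if $m(A\setminus B)=0$. A mean is invariant if $m(f(\cdot-\gamma))=m(f)$ for all $f\in\ell^\infty(\Gamma)$, $\gamma\in\Gamma$; an extreme invariant mean is an extreme point of the convex set of invariant means. An FS-mean is a mean $\eta$ such that for every action $U$ of $\Gamma$ by unitary operators on a complex Hilbert space $\mathcal H$ and all $v,w\in\mathcal H$, $\eta\bigl(\gamma\mapsto\langle v,U_\gamma w\rangle\bigr)=\langle v,Pw\rangle$, where $P$ is the orthogonal projection onto $\{x\in\mathcal H: U_\gamma x=x \text{ for all }\gamma\in\Gamma\}$. The upper Banach density of $A$ is $d^*(A):=\sup\{m(A): m \text{ an invariant mean}\}$. Let $b\Gamma$ be the Bohr compactification of $\Gamma$, and regard $\Gamma$ as a dense subgroup of it. A set $U\subseteq\Gamma$ is a Bohr neighborhood if there are $\gamma_0\in\Gamma$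 and an open $V\subseteq b\Gamma$ with $\gamma_0\in V$ and $V\cap\Gamma\subseteq U$. A set $T\subseteq\Gamma$ is thick if for every finite $F\subseteq\Gamma$ there is $t\in\Gamma$ with $F+t\subseteq T$; $S\subseteq\Gamma$ is syndetic if $S+F=\Gamma$ for some finite $F\subseteq\Gamma$. A set $C\subseteq\Gamma$ is piecewise Bohr (respectively piecewise syndetic) if $U\subset_m C$ for some invariant mean $m$ and some Bohr neighborhood (respectively some syndetic set) $U$. Let $A,B\subseteq\Gamma$, and let $A+B=\{a+b:a\in A,\ b\in B\}$. (i) If $d^*(A)>0$ and $\eta(B)>0$ for some FS-mean $\eta$, then $A+B$ is piecewise Bohr, and therefore piecewise syndetic. Furthermore, for every extreme invariant mean $\nu$ with $\nu(A)>0$ there is a Bohr neighborhood $U\subseteq\Gamma$ such that $U\subset_\nu A+B$. (ii) If $\nu$ is an extreme invariant mean, $\eta$ is an FS-mean, and $\nu(A)+\eta(B)>1$, then $\nu(A+B)=1$; consequently $A+B$ is thick. -/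

import Mathlib

open scoped ComplexOrder ENNReal Pointwise

universe u

namespace SumsetMeans

/-- The Banach space of bounded complex-valued functions on `Γ`, with the supremum norm. -/
abbrev LInf (Γ : Type u) : Type u := lp (fun _ : Γ => ℂ) ∞

/-- A function with a uniform bound, as an element of `LInf Γ`. -/
def mkLInf {Γ : Type u} (f : Γ → ℂ) (C : ℝ) (hC : ∀ x, ‖f x‖ ≤ C) : LInf Γ :=
  ⟨f, memℓp_infty ⟨C, by rintro _ ⟨x, rfl⟩; exact hC x⟩⟩

open Classical in
/-- The indicator function `1_A` of a set `A`. -/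
noncomputable def ind {Γ : Type u} (A : Set Γ) : LInf Γ :=
  mkLInf (fun x => if x ∈ A then 1 else 0) 1 (by intro x; split_ifs <;> simp)

/-- The translate `f_γ`, given by `f_γ(x) = f(x - γ)`. -/
noncomputable def translate {Γ : Type u} [AddCommGroup Γ] (γ : Γ) (f : LInf Γ) : LInf Γ :=
  mkLInf (fun x => f (x - γ)) ‖f‖ (fun x => lp.norm_apply_le_norm ENNReal.top_ne_zero f (x - γ))

/-- A mean: a linear functional `m` on `ℓ^∞(Γ)` with `m(1) = 1` and `m(f) ≥ 0` whenever `f ≥ 0`.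
Here `0 ≤ z` for a complex `z` says that `z` is a nonnegative real number. -/
structure IsMean {Γ : Type u} (m : LInf Γ →ₗ[ℂ] ℂ) : Prop where
  map_one : m 1 = 1
  nonneg : ∀ f : LInf Γ, (∀ x, 0 ≤ f x) → 0 ≤ m f

/-- The set of (translation) invariant means on `ℓ^∞(Γ)`. -/
def invariantMeans (Γ : Type u) [AddCommGroup Γ] : Set (LInf Γ →ₗ[ℂ] ℂ) :=
  {m | IsMean m ∧ ∀ (f : LInf Γ) (γ : Γ), m (translate γ f) = m f}

/-- The set of extreme invariant means: the extreme points of the convex set of invariant means. -/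
def extremeInvariantMeans (Γ : Type u) [AddCommGroup Γ] : Set (LInf Γ →ₗ[ℂ] ℂ) :=
  Set.extremePoints ℝ (invariantMeans Γ)

/-- The finitely additive measure `m(A) = m(1_A)` induced by a mean `m`
(for a mean, `m(1_A)` is a nonnegative real number). -/
noncomputable def meas {Γ : Type u} (m : LInf Γ →ₗ[ℂ] ℂ) (A : Set Γ) : ℝ := (m (ind A)).re

/-- Essential containment `A ⊂_m B`, that is, `m(A \ B) = 0`. -/
def EssSubset {Γ : Type u} (m : LInf Γ →ₗ[ℂ] ℂ) (A B : Set Γ) : Prop := meas m (A \ B) = 0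

/-- Upper Banach density: `d*(A) = sup {m(A) : m an invariant mean}`. -/
noncomputable def upperBanachDensity {Γ : Type u} [AddCommGroup Γ] (A : Set Γ) : ℝ :=
  sSup ((fun m => meas m A) '' invariantMeans Γ)

section UnitaryAction

variable {Γ : Type u} [AddCommGroup Γ] {H : Type u} [NormedAddCommGroup H] [InnerProductSpace ℂ H]

/-- The closed subspace of vectors fixed by a unitary action `U` of `Γ` on `H`. -/
def invSubspace (U : Multiplicative Γ →* (H ≃ₗᵢ[ℂ] H)) : Submodule ℂ H where
  carrier := {x | ∀ γ : Γ, U (Multiplicative.ofAdd γ) x = x}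
  add_mem' := by
    intro a b ha hb γ
    rw [map_add, ha γ, hb γ]
  zero_mem' := by
    intro γ
    exact map_zero _
  smul_mem' := by
    intro c x hx γ
    rw [map_smul, hx γ]

theorem isClosed_invSubspace (U : Multiplicative Γ →* (H ≃ₗᵢ[ℂ] H)) :
    IsClosed (invSubspace U : Set H) := by
  have h : (invSubspace U : Set H) = ⋂ γ : Γ, {x | U (Multiplicative.ofAdd γ) x = x} := by
    ext x
    simp [invSubspace]
  rw [h]
  exact isClosed_iInter fun γ => isClosed_eq (LinearIsometryEquiv.continuous _) continuous_id

instance [CompleteSpace H] (U : Multiplicative Γ →* (H ≃ₗᵢ[ℂ] H)) :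
    (invSubspace U).HasOrthogonalProjection :=
  have := (isClosed_invSubspace U).completeSpace_coe
  Submodule.HasOrthogonalProjection.ofCompleteSpace _

/-- The matrix coefficient `φ_{v,w}(γ) = ⟨v, U_γ w⟩`, for the inner product that is linear in the
first variable (Mathlib's `inner ℂ` is linear in the second). -/
noncomputable def matrixCoeff (U : Multiplicative Γ →* (H ≃ₗᵢ[ℂ] H)) (v w : H) : LInf Γ :=
  mkLInf (fun γ => inner ℂ (U (Multiplicative.ofAdd γ) w) v) (‖w‖ * ‖v‖) (fun γ => by
    simpa using norm_inner_le_norm (𝕜 := ℂ) (U (Multiplicative.ofAdd γ) w) v)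

end UnitaryAction

/-- The set of FS-means: the means `η` such that `η(φ_{v,w}) = ⟨v, P w⟩` for every unitary action
of `Γ` on a complex Hilbert space `H` and all `v, w ∈ H`, where `P` is the orthogonal projection
onto the subspace of invariant vectors. A matrix coefficient only depends on the closed linear span
of one orbit, which is isometric to a Hilbert space in the universe of `Γ`, so that it is enough to
let `H` range over that universe. -/
def fsMeans (Γ : Type u) [AddCommGroup Γ] : Set (LInf Γ →ₗ[ℂ] ℂ) :=
  {η | IsMean η ∧
    ∀ (H : Type u) [NormedAddCommGroup H] [InnerProductSpace ℂ H] [CompleteSpace H]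
      (U : Multiplicative Γ →* (H ≃ₗᵢ[ℂ] H)) (v w : H),
      η (matrixCoeff U v w) = inner ℂ ((invSubspace U).starProjection w) v}

section Bohr

variable (Γ : Type u) [AddCommGroup Γ]

/-- The homomorphism `γ ↦ (χ(γ))_χ` from `Γ` to the product of copies of the circle group (written
additively) over all characters `χ` of the discrete group `Γ`. -/
noncomputable def evalHom : Γ →+ (AddChar Γ Circle → Additive Circle) where
  toFun γ χ := Additive.ofMul (χ γ)
  map_zero' := by
    funext χ
    simp
  map_add' := by
    intro a b
    funext χ
    simp [AddChar.map_add_eq_mul]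

/-- The Bohr compactification `bΓ` of the discrete group `Γ`, realized as the closure of the image
of `Γ` in the product of circles over all characters of `Γ` (product topology). -/
noncomputable def BohrCompactification : AddSubgroup (AddChar Γ Circle → Additive Circle) :=
  (evalHom Γ).range.topologicalClosure

variable {Γ}

/-- The canonical embedding of `Γ` in its Bohr compactification. -/
noncomputable def bohrEmbedding : Γ →+ BohrCompactification Γ :=
  (evalHom Γ).codRestrict (BohrCompactification Γ)
    (fun γ => (evalHom Γ).range.le_topologicalClosure ⟨γ, rfl⟩)

/-- `U` is a Bohr neighborhood of `γ₀`: there is an open `V ⊆ bΓ` with `γ₀ ∈ V` and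
`V ∩ Γ ⊆ U`. -/
def IsBohrNhdOf (γ₀ : Γ) (U : Set Γ) : Prop :=
  ∃ V : Set (BohrCompactification Γ), IsOpen V ∧ bohrEmbedding γ₀ ∈ V ∧ bohrEmbedding ⁻¹' V ⊆ U

/-- `U` is a Bohr neighborhood (of some element of `Γ`). -/
def IsBohrNhd (U : Set Γ) : Prop := ∃ γ₀ : Γ, IsBohrNhdOf γ₀ U

/-- `C` is piecewise Bohr: `U ⊂_m C` for some invariant mean `m` and Bohr neighborhood `U`. -/
def IsPiecewiseBohr (C : Set Γ) : Prop :=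
  ∃ m ∈ invariantMeans Γ, ∃ U : Set Γ, IsBohrNhd U ∧ EssSubset m U C

/-- `T` is thick: it contains a translate of every finite set. -/
def IsThick (T : Set Γ) : Prop :=
  ∀ F : Set Γ, F.Finite → ∃ t : Γ, F + {t} ⊆ T

/-- `S` is syndetic: finitely many translates of it cover `Γ`. -/
def IsSyndetic (S : Set Γ) : Prop :=
  ∃ F : Set Γ, F.Finite ∧ S + F = Set.univ

/-- `C` is piecewise syndetic: `S ⊂_m C` for some invariant mean `m` and syndetic set `S`. -/
def IsPiecewiseSyndetic (C : Set Γ) : Prop :=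
  ∃ m ∈ invariantMeans Γ, ∃ S : Set Γ, IsSyndetic S ∧ EssSubset m S C

end Bohr

end SumsetMeans

open SumsetMeans

/-! Everything rests on the correlation function `γ ↦ ν((A + γ) ∩ D)`. It is a matrix coefficient of
the translation action on the Hilbert space `L²(ν)`, so FS-means can evaluate it. If `D` is disjoint
from `A + B`, it vanishes on `B`.

An extreme invariant mean is ergodic. For `0 ≤ f ≤ 1` the functional `g ↦ ⟨P f, g⟩` is, up to
scaling, an invariant mean, and the functionals of `f` and `1 - f` add up to `ν`; extremality gives
`P f = ν(f) 1` (`starProjection_gnsVec`). Hence the `η`-average of the correlation is `ν(A) ν(D)`.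
With `D` the complement of `A + B` this is at most `ν(D) (1 - η(B))`, so `ν(D) = 0` when `ν(A) +
η(B) > 1` (`meas_add_eq_one`). Thickness follows because finitely many translates of a set of
measure one meet.

For the Bohr statement the correlation is averaged with weight `1_B`. The part of `1_A` orthogonal
to the characters contributes nothing: it is weakly mixing along `η` (`mean_norm_sq_coeff_eq_zero`).
What remains is integration over `D` of `h = ∑ c_χ d_χ χ`, where `c` and `d` are the Fourier
coefficients of `1_A` in `L²(ν)` and of `1_B` in `L²(η)` (`exists_charSeries`). Both are square
summable, so `h` extends continuously to the Bohr compactification, and `ν(h) = ν(A) η(B) > 0`. The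
set where `Re h` exceeds half of this value is a Bohr neighborhood, and its part outside `A + B` is
`ν`-null. Krein–Milman supplies an extreme `ν` charging `A`. -/

namespace SumsetMeans

open ComplexConjugate UniformSpace Module

/-! ### Means, their `L²` spaces and finitely additive measures -/

section Mean

variable {X : Type u}

@[simp] theorem mkLInf_apply (f : X → ℂ) (C : ℝ) (hC : ∀ x, ‖f x‖ ≤ C) (x : X) :
    mkLInf f C hC x = f x := rfl

@[simp] theorem ind_apply_mem {A : Set X} {x : X} (hx : x ∈ A) : ind A x = 1 := by
  simp [ind, hx]

@[simp] theorem ind_apply_notMem {A : Set X} {x : X} (hx : x ∉ A) : ind A x = 0 := by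
  simp [ind, hx]

theorem LInf.ext {f g : LInf X} (h : ∀ x, f x = g x) : f = g := lp.ext (funext h)

theorem LInf.norm_apply_le (f : LInf X) (x : X) : ‖f x‖ ≤ ‖f‖ :=
  lp.norm_apply_le_norm ENNReal.top_ne_zero f x

theorem norm_mkLInf_le (f : X → ℂ) {C : ℝ} (hC : ∀ x, ‖f x‖ ≤ C) (h0 : 0 ≤ C) :
    ‖mkLInf f C hC‖ ≤ C :=
  lp.norm_le_of_forall_le h0 hC

@[simp] theorem LInf.one_apply (x : X) : (1 : LInf X) x = 1 := rfl
@[simp] theorem LInf.mul_apply (f g : LInf X) (x : X) : (f * g) x = f x * g x := rfl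
@[simp] theorem LInf.star_apply (f : LInf X) (x : X) : (star f) x = conj (f x) := rfl
@[simp] theorem LInf.add_apply (f g : LInf X) (x : X) : (f + g) x = f x + g x := rfl
@[simp] theorem LInf.sub_apply (f g : LInf X) (x : X) : (f - g) x = f x - g x := rfl
@[simp] theorem LInf.smul_apply (c : ℂ) (f : LInf X) (x : X) : (c • f) x = c * f x := rfl

theorem LInf.star_star_mul (f g : LInf X) : star (star f * g) = star g * f :=
  LInf.ext fun x => by simp [mul_comm]

variable {m : LInf X →ₗ[ℂ] ℂ}

theorem IsMean.mono (hm : IsMean m) {f g : LInf X} (h : ∀ x, f x ≤ g x) : m f ≤ m g := by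
  have := hm.nonneg (g - f) fun x => by simpa using h x
  simpa using this

theorem IsMean.im_eq_zero (hm : IsMean m) {f : LInf X} (hf : ∀ x, (f x).im = 0) :
    (m f).im = 0 := by
  -- Adding the constant `‖f‖` makes a real function nonnegative and changes the mean by a real
  -- number.
  have h := hm.nonneg (f + (‖f‖ : ℂ) • (1 : LInf X)) fun x => by
    have h1 := LInf.norm_apply_le f x
    have h2 := (abs_le.1 ((Complex.abs_re_le_norm (f x)).trans h1)).1
    refine Complex.le_def.2 ⟨?_, ?_⟩
    · simp only [Complex.zero_re, LInf.add_apply, LInf.smul_apply, LInf.one_apply, mul_one,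
        Complex.add_re, Complex.ofReal_re]
      linarith
    · simp only [Complex.zero_im, LInf.add_apply, LInf.smul_apply, LInf.one_apply, mul_one,
        Complex.add_im, Complex.ofReal_im, hf x, add_zero]
  rw [map_add, map_smul, hm.map_one, Complex.le_def] at h
  simpa using h.2.symm

theorem IsMean.map_star (hm : IsMean m) (f : LInf X) : m (star f) = conj (m f) := by
  have h1 := hm.im_eq_zero (f := f + star f) (by simp)
  have h2 := hm.im_eq_zero (f := Complex.I • (f - star f)) (by simp)
  simp only [map_add, map_sub, map_smul, Complex.add_im, smul_eq_mul, Complex.mul_im,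
    Complex.sub_re, Complex.I_re, Complex.I_im, zero_mul, one_mul, zero_add] at h1 h2
  apply Complex.ext
  · simp; linarith
  · simp; linarith

theorem IsMean.self_nonneg (hm : IsMean m) (f : LInf X) : 0 ≤ m (star f * f) :=
  hm.nonneg _ fun x => by
    have : (star f * f) x = ((‖f x‖ ^ 2 : ℝ) : ℂ) := by
      simp [Complex.conj_mul']
    rw [this]
    exact Complex.zero_le_real.2 (sq_nonneg _)

/-- The pre-Hilbert space `ℓ^∞(X)` with the inner product `⟨f, g⟩ = m(f̄ g)`. -/
def PreGNS (m : LInf X →ₗ[ℂ] ℂ) (_ : IsMean m) : Type u := LInf X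

variable (hm : IsMean m)

noncomputable instance : AddCommGroup (PreGNS m hm) := inferInstanceAs (AddCommGroup (LInf X))

noncomputable instance : Module ℂ (PreGNS m hm) := inferInstanceAs (Module ℂ (LInf X))

/-- The identity map from `ℓ^∞(X)` to the pre-Hilbert space of a mean. -/
noncomputable def PreGNS.of : LInf X ≃ₗ[ℂ] PreGNS m hm := LinearEquiv.refl ℂ (LInf X)

noncomputable instance : PreInnerProductSpace.Core ℂ (PreGNS m hm) where
  inner f g := m (star ((PreGNS.of hm).symm f) * (PreGNS.of hm).symm g)
  conj_inner_symm f g := by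
    rw [← hm.map_star, LInf.star_star_mul]
  re_inner_nonneg f := (Complex.le_def.1 (hm.self_nonneg _)).1
  add_left f g h := by
    rw [map_add, star_add, add_mul, map_add]
  smul_left f g c := by
    rw [map_smul, star_smul, smul_mul_assoc, map_smul]; rfl

noncomputable instance : SeminormedAddCommGroup (PreGNS m hm) :=
  InnerProductSpace.Core.toSeminormedAddCommGroup (𝕜 := ℂ)

noncomputable instance : InnerProductSpace ℂ (PreGNS m hm) := .ofCore _

theorem PreGNS.inner_of (f g : LInf X) :
    inner ℂ (PreGNS.of hm f) (PreGNS.of hm g) = m (star f * g) := rfl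

/-- The Hilbert space `L²(m)` of a mean `m`. -/
abbrev GNS : Type u := Completion (PreGNS m hm)

/-- The canonical map from `ℓ^∞(X)` to `L²(m)`. -/
noncomputable def gnsVec : LInf X →ₗ[ℂ] GNS hm :=
  (Completion.toComplL : PreGNS m hm →L[ℂ] GNS hm).toLinearMap ∘ₗ (PreGNS.of hm).toLinearMap

theorem gnsVec_eq (f : LInf X) : gnsVec hm f = ((PreGNS.of hm f : PreGNS m hm) : GNS hm) := rfl

@[simp] theorem inner_gnsVec (f g : LInf X) :
    inner ℂ (gnsVec hm f) (gnsVec hm g) = m (star f * g) := by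
  rw [gnsVec_eq, gnsVec_eq, Completion.inner_coe, PreGNS.inner_of]

theorem denseRange_gnsVec : DenseRange (gnsVec hm) := by
  have : (gnsVec hm : LInf X → GNS hm) = (fun a : PreGNS m hm => (a : GNS hm)) ∘ PreGNS.of hm :=
    rfl
  rw [this, DenseRange, (PreGNS.of hm).surjective.range_comp]
  exact Completion.denseRange_coe

theorem norm_sq_gnsVec (f : LInf X) : ((‖gnsVec hm f‖ ^ 2 : ℝ) : ℂ) = m (star f * f) := by
  rw [← inner_gnsVec hm, inner_self_eq_norm_sq_to_K]; simp

theorem norm_gnsVec_le (f : LInf X) : ‖gnsVec hm f‖ ≤ ‖f‖ := by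
  have h : ((‖gnsVec hm f‖ ^ 2 : ℝ) : ℂ) ≤ ((‖f‖ ^ 2 : ℝ) : ℂ) := by
    rw [norm_sq_gnsVec]
    have := hm.mono (f := star f * f) (g := ((‖f‖ ^ 2 : ℝ) : ℂ) • (1 : LInf X)) fun x => by
      have : (star f * f) x = ((‖f x‖ ^ 2 : ℝ) : ℂ) := by
        simp [Complex.conj_mul']
      rw [this, LInf.smul_apply, LInf.one_apply, mul_one, Complex.real_le_real]
      exact pow_le_pow_left₀ (norm_nonneg _) (LInf.norm_apply_le f x) 2
    rwa [map_smul, hm.map_one, smul_eq_mul, mul_one] at this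
  rw [Complex.real_le_real] at h
  exact (sq_le_sq₀ (norm_nonneg _) (norm_nonneg _)).1 h

theorem IsMean.norm_le (hm : IsMean m) (f : LInf X) : ‖m f‖ ≤ ‖f‖ := by
  have h1 : m f = inner ℂ (gnsVec hm 1) (gnsVec hm f) := by simp
  have h2 : ‖gnsVec hm 1‖ ≤ 1 :=
    (norm_gnsVec_le hm 1).trans (norm_mkLInf_le (fun _ => (1 : ℂ)) (by simp) zero_le_one)
  rw [h1]
  calc _ ≤ ‖gnsVec hm 1‖ * ‖gnsVec hm f‖ := norm_inner_le_norm _ _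
    _ ≤ 1 * ‖f‖ := by gcongr; exact norm_gnsVec_le hm f
    _ = ‖f‖ := one_mul _

/-- The Cauchy–Schwarz inequality for a mean. -/
theorem IsMean.norm_sq_le (hm : IsMean m) (f g : LInf X) :
    ‖m (f * g)‖ ^ 2 ≤ ‖f‖ ^ 2 * (m (star g * g)).re := by
  have h1 : m (f * g) = inner ℂ (gnsVec hm (star f)) (gnsVec hm g) := by simp
  rw [h1, ← norm_sq_gnsVec hm g, Complex.ofReal_re, ← mul_pow]
  gcongr
  refine (norm_inner_le_norm _ _).trans ?_
  gcongr
  simpa using norm_gnsVec_le hm (star f)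

/-- A mean as a continuous linear functional. -/
noncomputable def IsMean.toCLM (hm : IsMean m) : LInf X →L[ℂ] ℂ :=
  m.mkContinuous 1 fun f => by simpa using hm.norm_le f

@[simp] theorem IsMean.toCLM_apply (hm : IsMean m) (f : LInf X) : hm.toCLM f = m f := rfl

theorem IsMean.meas_nonneg (hm : IsMean m) (A : Set X) : 0 ≤ meas m A := by
  have := hm.nonneg (ind A) fun x => by
    by_cases hx : x ∈ A <;> simp [hx]
  exact (Complex.le_def.1 this).1

theorem IsMean.map_ind (hm : IsMean m) (A : Set X) : m (ind A) = (meas m A : ℂ) := by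
  apply Complex.ext
  · simp [meas]
  · rw [hm.im_eq_zero]
    · simp
    · intro x
      by_cases hx : x ∈ A <;> simp [hx]

theorem IsMean.meas_mono (hm : IsMean m) {A B : Set X} (h : A ⊆ B) : meas m A ≤ meas m B := by
  have := hm.mono (f := ind A) (g := ind B) fun x => by
    by_cases hx : x ∈ A
    · simp [hx, h hx]
    · by_cases hx' : x ∈ B <;> simp [hx, hx']
  exact (Complex.le_def.1 this).1

theorem ind_compl (A : Set X) : ind Aᶜ = 1 - ind A :=
  LInf.ext fun x => by by_cases hx : x ∈ A <;> simp [hx]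

theorem IsMean.meas_compl (hm : IsMean m) (A : Set X) : meas m Aᶜ = 1 - meas m A := by
  simp [meas, ind_compl, hm.map_one]

theorem IsMean.meas_union_le (hm : IsMean m) (A B : Set X) :
    meas m (A ∪ B) ≤ meas m A + meas m B := by
  have := hm.mono (f := ind (A ∪ B)) (g := ind A + ind B) fun x => by
    by_cases hx : x ∈ A
    · by_cases hx' : x ∈ B <;> simp [hx, hx']
    · by_cases hx' : x ∈ B <;> simp [hx, hx']
  rw [map_add] at this
  exact (Complex.le_def.1 this).1

@[simp] theorem star_ind (A : Set X) : star (ind A) = ind A :=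
  LInf.ext fun x => by by_cases hx : x ∈ A <;> simp [hx]

end Mean

/-! ### Extending unitary representations to completions -/

section CompletionRep

theorem rep_mul {G : Type*} [Monoid G] {E : Type*} [SeminormedAddCommGroup E] [Module ℂ E]
    (U : G →* (E ≃ₗᵢ[ℂ] E)) (g h : G) (x : E) : U (g * h) x = U g (U h x) := by
  rw [map_mul]; rfl

variable {E : Type u} [SeminormedAddCommGroup E] [InnerProductSpace ℂ E]

/-- The extension of a linear isometry to the completion. -/
noncomputable def completionIsometry (U : E →ₗᵢ[ℂ] E) : Completion E →ₗᵢ[ℂ] Completion E where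
  toFun := Completion.map U
  map_add' x y := by
    refine Completion.induction_on₂ x y (isClosed_eq ?_ ?_) fun a b => ?_
    · exact (Completion.continuous_map (f := U)).comp continuous_add
    · exact ((Completion.continuous_map (f := U)).comp continuous_fst).add
        ((Completion.continuous_map (f := U)).comp continuous_snd)
    · rw [← Completion.coe_add, Completion.map_coe U.isometry.uniformContinuous,
        Completion.map_coe U.isometry.uniformContinuous,
        Completion.map_coe U.isometry.uniformContinuous, map_add, Completion.coe_add]
  map_smul' c x := by
    refine Completion.induction_on x (isClosed_eq ?_ ?_) fun a => ?_
    · exact (Completion.continuous_map (f := U)).comp (continuous_const_smul c)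
    · exact (continuous_const_smul c).comp (Completion.continuous_map (f := U))
    · rw [← Completion.coe_smul, Completion.map_coe U.isometry.uniformContinuous,
        Completion.map_coe U.isometry.uniformContinuous, map_smul, Completion.coe_smul]; rfl
  norm_map' x := by
    refine Completion.induction_on x (isClosed_eq ?_ ?_) fun a => ?_
    · exact continuous_norm.comp Completion.continuous_map
    · exact continuous_norm
    · change ‖Completion.map U (a : Completion E)‖ = _
      rw [Completion.map_coe U.isometry.uniformContinuous, Completion.norm_coe,
        Completion.norm_coe, U.norm_map]

@[simp] theorem completionIsometry_coe (U : E →ₗᵢ[ℂ] E) (x : E) :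
    completionIsometry U (x : Completion E) = (U x : E) :=
  Completion.map_coe U.isometry.uniformContinuous x

theorem completion_ext {E F : Type*} [UniformSpace E] [TopologicalSpace F] [T2Space F] {f g : Completion E → F}
    (hf : Continuous f) (hg : Continuous g) (h : ∀ x : E, f x = g x) (x : Completion E) :
    f x = g x :=
  congrFun (Completion.ext hf hg h) x

/-- The extension of a unitary operator to the completion. -/
noncomputable def completionUnitary (U : E ≃ₗᵢ[ℂ] E) : Completion E ≃ₗᵢ[ℂ] Completion E :=
  LinearIsometryEquiv.mk
    (LinearEquiv.ofLinearMap (completionIsometry U.toLinearIsometry).toLinearMap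
      (completionIsometry U.symm.toLinearIsometry).toLinearMap
      (LinearMap.ext fun x => completion_ext
        ((completionIsometry _).continuous.comp (completionIsometry _).continuous)
        continuous_id (fun a => by simp) x)
      (LinearMap.ext fun x => completion_ext
        ((completionIsometry _).continuous.comp (completionIsometry _).continuous)
        continuous_id (fun a => by simp) x))
    (fun x => (completionIsometry U.toLinearIsometry).norm_map x)

@[simp] theorem completionUnitary_coe (U : E ≃ₗᵢ[ℂ] E) (x : E) :
    completionUnitary U (x : Completion E) = (U x : E) :=
  completionIsometry_coe U.toLinearIsometry x

/-- The extension of a unitary representation to the completion. -/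
noncomputable def completionRep {G : Type*} [Monoid G] (U : G →* (E ≃ₗᵢ[ℂ] E)) :
    G →* (Completion E ≃ₗᵢ[ℂ] Completion E) where
  toFun g := completionUnitary (U g)
  map_one' := LinearIsometryEquiv.ext fun x =>
    completion_ext (LinearIsometryEquiv.continuous _) continuous_id (fun a => by simp) x
  map_mul' g h := LinearIsometryEquiv.ext fun x =>
    completion_ext (LinearIsometryEquiv.continuous _)
      ((completionUnitary (U g)).continuous.comp (completionUnitary (U h)).continuous)
      (fun a => by simp) x

@[simp] theorem completionRep_coe {G : Type*} [Monoid G] (U : G →* (E ≃ₗᵢ[ℂ] E)) (g : G) (x : E) :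
    completionRep U g (x : Completion E) = (U g x : E) :=
  completionUnitary_coe (U g) x

end CompletionRep

/-! ### Invariant vectors and twists by characters -/

section Rep

variable {Γ : Type u} [AddCommGroup Γ] {H : Type u} [NormedAddCommGroup H] [InnerProductSpace ℂ H]

theorem matrixCoeff_apply (U : Multiplicative Γ →* (H ≃ₗᵢ[ℂ] H)) (v w : H) (γ : Γ) :
    matrixCoeff U v w γ = inner ℂ (U (Multiplicative.ofAdd γ) w) v := rfl

theorem mem_invSubspace {U : Multiplicative Γ →* (H ≃ₗᵢ[ℂ] H)} {x : H} :
    x ∈ invSubspace U ↔ ∀ γ : Γ, U (Multiplicative.ofAdd γ) x = x := Iff.rfl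

theorem inner_rep_right_of_mem_invSubspace {U : Multiplicative Γ →* (H ≃ₗᵢ[ℂ] H)} {x : H}
    (hx : x ∈ invSubspace U) (γ : Γ) (y : H) :
    inner ℂ x (U (Multiplicative.ofAdd γ) y) = inner ℂ x y := by
  conv_lhs => rw [← mem_invSubspace.1 hx γ]
  exact LinearIsometryEquiv.inner_map_map _ _ _

/-- Multiplication by a complex number of modulus one, as a unitary operator. -/
noncomputable def circleSMul (c : Circle) : H ≃ₗᵢ[ℂ] H :=
  LinearIsometryEquiv.mk
    (LinearEquiv.smulOfNeZero ℂ H (c : ℂ) c.coe_ne_zero) (fun x => by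
      change ‖(c : ℂ) • x‖ = ‖x‖
      rw [norm_smul, Circle.norm_coe, one_mul])

@[simp] theorem circleSMul_apply (c : Circle) (x : H) : circleSMul c x = (c : ℂ) • x := rfl

/-- The twist of a unitary representation by a character. -/
noncomputable def twist (χ : AddChar Γ Circle) (U : Multiplicative Γ →* (H ≃ₗᵢ[ℂ] H)) :
    Multiplicative Γ →* (H ≃ₗᵢ[ℂ] H) where
  toFun g := circleSMul (χ g.toAdd) * U g
  map_one' := LinearIsometryEquiv.ext fun x => by simp
  map_mul' g h := LinearIsometryEquiv.ext fun x => by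
    change (χ (g * h).toAdd : ℂ) • U (g * h) x = (χ g.toAdd : ℂ) • U g ((χ h.toAdd : ℂ) • U h x)
    rw [rep_mul, map_smul, toAdd_mul, AddChar.map_add_eq_mul, Circle.coe_mul, mul_smul]

theorem twist_apply (χ : AddChar Γ Circle) (U : Multiplicative Γ →* (H ≃ₗᵢ[ℂ] H)) (γ : Γ) (x : H) :
    twist χ U (Multiplicative.ofAdd γ) x = (χ γ : ℂ) • U (Multiplicative.ofAdd γ) x := rfl

end Rep

/-! ### Conjugate spaces and the representation `U ⊗ Ū` -/

section Conj

/-- The conjugate of a complex vector space. -/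
def ConjSpace (H : Type u) : Type u := H

variable {H : Type u} [NormedAddCommGroup H] [InnerProductSpace ℂ H]

noncomputable instance : NormedAddCommGroup (ConjSpace H) := inferInstanceAs (NormedAddCommGroup H)

/-- The identity map from a space to its conjugate. -/
def ConjSpace.of : H ≃+ ConjSpace H := AddEquiv.refl H

noncomputable instance : Module ℂ (ConjSpace H) := Module.compHom H (starRingEnd ℂ)

theorem ConjSpace.of_smul (c : ℂ) (x : H) :
    ConjSpace.of (c • x) = conj c • ConjSpace.of x := by
  change c • x = (conj (conj c)) • x
  rw [Complex.conj_conj]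

noncomputable instance : InnerProductSpace ℂ (ConjSpace H) where
  norm_smul_le c x := by
    change ‖(conj c) • (show H from x)‖ ≤ ‖c‖ * ‖(show H from x)‖
    rw [norm_smul, RCLike.norm_conj]
  inner x y := inner ℂ (ConjSpace.of.symm y) (ConjSpace.of.symm x)
  norm_sq_eq_re_inner x := norm_sq_eq_re_inner (𝕜 := ℂ) (ConjSpace.of.symm x)
  conj_inner_symm x y := inner_conj_symm (ConjSpace.of.symm y) (ConjSpace.of.symm x)
  add_left x y z := by rw [map_add, inner_add_right]
  smul_left x y c := by
    change inner ℂ _ (conj c • ConjSpace.of.symm x) = _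
    rw [inner_smul_right]

theorem ConjSpace.inner_of (x y : H) :
    inner ℂ (ConjSpace.of x) (ConjSpace.of y) = inner ℂ y x := rfl

@[simp] theorem ConjSpace.norm_of {H : Type u} [NormedAddCommGroup H] (x : H) :
    ‖ConjSpace.of x‖ = ‖x‖ := rfl

/-- The unitary operator on the conjugate space given by a unitary operator. -/
noncomputable def conjUnitary (U : H ≃ₗᵢ[ℂ] H) : ConjSpace H ≃ₗᵢ[ℂ] ConjSpace H where
  toFun x := ConjSpace.of (U (ConjSpace.of.symm x))
  invFun x := ConjSpace.of (U.symm (ConjSpace.of.symm x))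
  left_inv x := by simp
  right_inv x := by simp
  map_add' x y := by simp
  map_smul' c x := by
    change U (conj c • ConjSpace.of.symm x) = conj c • U (ConjSpace.of.symm x)
    rw [map_smul]
  norm_map' x := U.norm_map _

@[simp] theorem conjUnitary_of (U : H ≃ₗᵢ[ℂ] H) (x : H) :
    conjUnitary U (ConjSpace.of x) = ConjSpace.of (U x) := rfl

open TensorProduct

/-- The representation `U ⊗ Ū` on the tensor product of a space with its conjugate. -/
noncomputable def tensorConjRep {G : Type*} [Monoid G] (U : G →* (H ≃ₗᵢ[ℂ] H)) :
    G →* ((H ⊗[ℂ] ConjSpace H) ≃ₗᵢ[ℂ] (H ⊗[ℂ] ConjSpace H)) where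
  toFun g := congrIsometry (U g) (conjUnitary (U g))
  map_one' := by
    refine LinearIsometryEquiv.toLinearEquiv_injective (LinearEquiv.toLinearMap_injective ?_)
    refine TensorProduct.ext' fun x y => ?_
    obtain ⟨y, rfl⟩ := ConjSpace.of.surjective y
    simp
  map_mul' g h := by
    refine LinearIsometryEquiv.toLinearEquiv_injective (LinearEquiv.toLinearMap_injective ?_)
    refine TensorProduct.ext' fun x y => ?_
    obtain ⟨y, rfl⟩ := ConjSpace.of.surjective y
    simp

@[simp] theorem tensorConjRep_tmul {G : Type*} [Monoid G] (U : G →* (H ≃ₗᵢ[ℂ] H)) (g : G)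
    (x y : H) :
    tensorConjRep U g (x ⊗ₜ ConjSpace.of y) = U g x ⊗ₜ ConjSpace.of (U g y) := by
  simp [tensorConjRep]

end Conj

/-! ### Compactness of positive operators of finite trace -/

section Compact

variable {H : Type*} [NormedAddCommGroup H] [InnerProductSpace ℂ H]

/-- Positivity of the form of `T` at `M v - T v`, with `M = ‖T‖ + 1`. The extra `1` keeps `M`
positive even when `T = 0`. -/
theorem norm_sq_le_of_nonneg {T : H →L[ℂ] H} (hT : T.toLinearMap.IsSymmetric)
    (hpos : ∀ v, 0 ≤ (inner ℂ (T v) v).re) (v : H) :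
    ‖T v‖ ^ 2 ≤ (‖T‖ + 1) * (inner ℂ (T v) v).re := by
  set M := ‖T‖ + 1 with hM
  have hM0 : 0 < M := by positivity
  have h1 := hpos ((M : ℂ) • v - T v)
  have h2 : (inner ℂ (T (T v)) (T v)).re ≤ ‖T‖ * ‖T v‖ ^ 2 := by
    refine (Complex.re_le_norm _).trans ((norm_inner_le_norm _ _).trans ?_)
    rw [sq, ← mul_assoc]
    gcongr
    exact T.le_opNorm _
  have h3 : inner ℂ (T (T v)) v = inner ℂ (T v) (T v) := hT (T v) v
  have h4 : inner ℂ (T v) (T v) = ((‖T v‖ ^ 2 : ℝ) : ℂ) := by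
    rw [inner_self_eq_norm_sq_to_K]; simp
  simp only [map_sub, map_smul, inner_sub_left, inner_sub_right, inner_smul_left, inner_smul_right,
    h3, h4, Complex.conj_ofReal, Complex.sub_re, Complex.re_ofReal_mul, Complex.ofReal_re] at h1
  have h5 : M * (M * (inner ℂ (T v) v).re - ‖T v‖ ^ 2) ≥ 0 := by nlinarith [sq_nonneg ‖T v‖]
  have := nonneg_of_mul_nonneg_right h5 hM0
  linarith

/-- A positive operator of finite trace is compact. -/
theorem isCompactOperator_of_trace_le [CompleteSpace H] {T : H →L[ℂ] H}
    (hT : T.toLinearMap.IsSymmetric)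
    (hpos : ∀ v, 0 ≤ (inner ℂ (T v) v).re) (C : ℝ)
    (hC : ∀ (n : ℕ) (e : Fin n → H), Orthonormal ℂ e → ∑ i, (inner ℂ (T (e i)) (e i)).re ≤ C) :
    IsCompactOperator T := by
  let S : Set ℝ := {r | ∃ (n : ℕ) (e : Fin n → H), Orthonormal ℂ e ∧
    r = ∑ i, (inner ℂ (T (e i)) (e i)).re}
  have hS : BddAbove S := ⟨C, by rintro _ ⟨n, e, he, rfl⟩; exact hC n e he⟩
  have hS0 : S.Nonempty := ⟨_, 0, Fin.elim0, by constructor <;> intro i <;> exact i.elim0, rfl⟩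
  have key : T ∈ closure {f : H →L[ℂ] H | IsCompactOperator f} := by
    rw [Metric.mem_closure_iff]
    intro ε hε
    set M := ‖T‖ + 1 with hM
    have hM0 : 0 < M := by positivity
    -- Chosen so that `M * δ = (ε / 2) ^ 2` in the bound of `norm_sq_le_of_nonneg`.
    set δ := (ε / 2) ^ 2 / M with hδ
    have hδ0 : 0 < δ := by positivity
    obtain ⟨_, ⟨n, e, he, rfl⟩, hlt⟩ := exists_lt_of_lt_csSup hS0 (sub_lt_self (sSup S) hδ0)
    let K : Submodule ℂ H := Submodule.span ℂ (Set.range e)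
    have : FiniteDimensional ℂ K := FiniteDimensional.span_of_finite ℂ (Set.finite_range e)
    -- The partial trace over `e` is within `δ` of the supremum, so adjoining one more unit vector
    -- gains at most `δ`. Thus `T` is small on `Kᗮ`, and the finite rank operator `T ∘ P_K`
    -- approximates it.
    have hunit : ∀ v ∈ Kᗮ, ‖v‖ = 1 → (inner ℂ (T v) v).re ≤ δ := by
      intro v hv hv1
      have ho : Orthonormal ℂ (Fin.cons v e : Fin (n + 1) → H) := by
        have hve : ∀ i, inner ℂ (e i) v = 0 := fun i =>
          hv (e i) (Submodule.subset_span ⟨i, rfl⟩)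
        constructor
        · intro i
          refine Fin.cases ?_ (fun i => ?_) i
          · simpa using hv1
          · simpa using he.1 i
        · intro i j
          refine Fin.cases ?_ (fun i => ?_) i <;> refine Fin.cases ?_ (fun j => ?_) j
          · simp
          · intro _; simpa using inner_eq_zero_symm.1 (hve j)
          · intro _; simpa using hve i
          · intro h; simpa using he.2 (fun hij => h (by rw [hij]))
      have := le_csSup hS ⟨n + 1, _, ho, rfl⟩
      rw [Fin.sum_univ_succ] at this
      simp only [Fin.cons_zero, Fin.cons_succ] at this
      linarith
    have hort : ∀ v ∈ Kᗮ, ‖T v‖ ≤ ε / 2 * ‖v‖ := by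
      intro v hv
      by_cases hv0 : v = 0
      · simp [hv0]
      have hn : ‖v‖ ≠ 0 := norm_ne_zero_iff.2 hv0
      set w : H := ((‖v‖⁻¹ : ℝ) : ℂ) • v with hw
      have hw1 : ‖w‖ = 1 := by
        rw [hw, norm_smul, Complex.norm_real, norm_inv, norm_norm, inv_mul_cancel₀ hn]
      have h1 := norm_sq_le_of_nonneg hT hpos w
      have h2 := hunit w (Kᗮ.smul_mem _ hv) hw1
      have h3 : ‖T w‖ ^ 2 ≤ (ε / 2) ^ 2 := by
        calc _ ≤ M * δ := h1.trans (by gcongr)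
          _ = _ := by rw [hδ]; field_simp
      have h4 : ‖T w‖ ≤ ε / 2 := (sq_le_sq₀ (norm_nonneg _) (by positivity)).1 h3
      have h5 : v = ((‖v‖ : ℝ) : ℂ) • w := by
        rw [hw, smul_smul, ← Complex.ofReal_mul, mul_inv_cancel₀ hn]; simp
      calc ‖T v‖ = ‖v‖ * ‖T w‖ := by
            conv_lhs => rw [h5, map_smul, norm_smul, Complex.norm_real, norm_norm]
        _ ≤ ‖v‖ * (ε / 2) := by gcongr
        _ = _ := mul_comm _ _
    refine ⟨T ∘L K.starProjection, ?_, ?_⟩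
    · have h1 : IsCompactOperator K.orthogonalProjectionOnto :=
        isCompactOperator_of_locallyCompactSpace_dom K.orthogonalProjectionOnto
      exact (h1.clm_comp K.subtypeL).clm_comp T
    · rw [dist_eq_norm]
      refine lt_of_le_of_lt (ContinuousLinearMap.opNorm_le_bound _ (by positivity : 0 ≤ ε / 2)
        fun v => ?_) (half_lt_self hε)
      have : (T - T ∘L K.starProjection) v = T (v - K.starProjection v) := by simp
      rw [this]
      refine (hort _ (K.sub_starProjection_mem_orthogonal v)).trans ?_
      gcongr
      rw [← Submodule.starProjection_orthogonal_val]
      exact Submodule.norm_starProjection_apply_le _ v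
  exact isClosed_setOfPred_isCompactOperator.closure_subset key

end Compact

/-! ### Joint eigenvectors of commuting unitaries -/

section JointEigenvector

variable {Γ : Type*} [AddCommGroup Γ] {H : Type*} [NormedAddCommGroup H] [InnerProductSpace ℂ H]

/-- Either every operator is scalar on `W`, or some `U g` has an eigenspace meeting `W` in a nonzero
proper subspace; that subspace is invariant because `Γ` is abelian, so the dimension drops. -/
theorem exists_joint_eigenvector (U : Multiplicative Γ →* (H ≃ₗᵢ[ℂ] H)) (n : ℕ)
    (W : Submodule ℂ H) [FiniteDimensional ℂ W] (hn : finrank ℂ W ≤ n) (hW : W ≠ ⊥)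
    (hinv : ∀ g, ∀ x ∈ W, U g x ∈ W) :
    ∃ e ∈ W, e ≠ 0 ∧ ∀ g, ∃ c : ℂ, U g e = c • e := by
  induction n generalizing W with
  | zero =>
    exact absurd (Submodule.finrank_eq_zero.1 (Nat.le_zero.1 hn)) hW
  | succ n ih =>
    by_cases hsc : ∀ g, ∃ c : ℂ, ∀ x ∈ W, U g x = c • x
    · obtain ⟨e, he, he0⟩ := Submodule.exists_mem_ne_zero_of_ne_bot hW
      exact ⟨e, he, he0, fun g => (hsc g).imp fun c hc => hc e he⟩
    · push Not at hsc
      obtain ⟨g, hg⟩ := hsc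
      have : Nontrivial W := Submodule.nontrivial_iff_ne_bot.2 hW
      let f : End ℂ W := (U g).toLinearEquiv.toLinearMap.restrict (hinv g)
      obtain ⟨c, hc⟩ := End.exists_eigenvalue f
      obtain ⟨x, hx⟩ := hc.exists_hasEigenvector
      have hxc : U g x = c • (x : H) := congrArg Subtype.val hx.apply_eq_smul
      let E : Submodule ℂ H := LinearMap.ker ((U g).toLinearEquiv.toLinearMap - c • LinearMap.id)
      have hE : ∀ y, y ∈ E ↔ U g y = c • y := fun y => by
        simp [E, LinearMap.mem_ker, sub_eq_zero]
      have hlt : W ⊓ E < W := by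
        refine lt_of_le_of_ne inf_le_left fun h => ?_
        obtain ⟨y, hy, hyc⟩ := hg c
        exact hyc ((hE y).1 (inf_eq_left.1 h hy))
      obtain ⟨e, he, he0, hch⟩ := ih (W ⊓ E)
        (Nat.lt_succ_iff.1 ((Submodule.finrank_lt_finrank_of_lt hlt).trans_le hn))
        (fun h => hx.2 (Subtype.ext ((Submodule.eq_bot_iff _).1 h x ⟨x.2, (hE _).2 hxc⟩)))
        (fun h y hy => ⟨hinv h y hy.1, (hE _).2 (by
          have : U g (U h y) = U h (U g y) := by
            rw [← rep_mul, ← rep_mul, mul_comm]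
          rw [this, (hE y).1 hy.2, map_smul])⟩)
      exact ⟨e, he.1, he0, hch⟩

/-- The character by which a unitary representation acts on a joint eigenvector. -/
theorem exists_char_of_joint_eigenvector (U : Multiplicative Γ →* (H ≃ₗᵢ[ℂ] H)) {e : H}
    (he : e ≠ 0) (h : ∀ g, ∃ c : ℂ, U g e = c • e) :
    ∃ χ : AddChar Γ Circle, ∀ γ : Γ, U (Multiplicative.ofAdd γ) e = (χ γ : ℂ) • e := by
  choose c hc using h
  have hnorm : ∀ g, ‖c g‖ = 1 := fun g => by
    have h1 := (U g).norm_map e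
    rw [hc, norm_smul] at h1
    exact mul_right_cancel₀ (norm_ne_zero_iff.2 he) (h1.trans (one_mul _).symm)
  have hinj : ∀ {a b : ℂ}, a • e = b • e → a = b := fun {a b} hab => smul_left_injective ℂ he hab
  refine ⟨⟨fun γ => ⟨c (Multiplicative.ofAdd γ), mem_sphere_zero_iff_norm.2 (hnorm _)⟩, ?_, ?_⟩,
    fun γ => hc _⟩
  · refine Subtype.ext (hinj ?_)
    rw [← hc]
    simp
  · intro a b
    refine Subtype.ext (hinj ?_)
    change c _ • e = (c _ * c _) • e
    rw [← hc, ofAdd_add, rep_mul, hc, map_smul, hc, smul_smul,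
      mul_comm]

end JointEigenvector

/-! ### Weak mixing along an FS-mean -/

section WeakMixing

open TensorProduct

variable {Γ : Type u} [AddCommGroup Γ] {H : Type u} [NormedAddCommGroup H] [InnerProductSpace ℂ H]

/-- The tensor `a ⊗ b̄` in the Hilbert tensor product. -/
noncomputable def conjTensor (a b : H) : Completion (H ⊗[ℂ] ConjSpace H) :=
  ((a ⊗ₜ[ℂ] ConjSpace.of b : H ⊗[ℂ] ConjSpace H) : Completion (H ⊗[ℂ] ConjSpace H))

theorem inner_conjTensor (a b c d : H) :
    inner ℂ (conjTensor a b) (conjTensor c d) = inner ℂ a c * inner ℂ d b := by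
  rw [conjTensor, conjTensor, Completion.inner_coe, TensorProduct.inner_tmul, ConjSpace.inner_of]

theorem norm_conjTensor (a b : H) : ‖conjTensor a b‖ = ‖a‖ * ‖b‖ := by
  rw [conjTensor, Completion.norm_coe, TensorProduct.norm_tmul, ConjSpace.norm_of]

theorem conjTensor_add_left (a a' b : H) :
    conjTensor (a + a') b = conjTensor a b + conjTensor a' b := by
  simp [conjTensor, TensorProduct.add_tmul, Completion.coe_add]

theorem conjTensor_add_right (a b b' : H) :
    conjTensor a (b + b') = conjTensor a b + conjTensor a b' := by
  simp [conjTensor, TensorProduct.tmul_add, Completion.coe_add]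

theorem conjTensor_smul_left (c : ℂ) (a b : H) :
    conjTensor (c • a) b = c • conjTensor a b := by
  rw [conjTensor, conjTensor, ← Completion.coe_smul, TensorProduct.smul_tmul']

theorem conjTensor_smul_right (c : ℂ) (a b : H) :
    conjTensor a (c • b) = conj c • conjTensor a b := by
  rw [conjTensor, conjTensor, ← Completion.coe_smul, ConjSpace.of_smul, TensorProduct.tmul_smul]

/-- The representation `U ⊗ Ū` on the Hilbert tensor product. -/
noncomputable def conjTensorRep (U : Multiplicative Γ →* (H ≃ₗᵢ[ℂ] H)) :
    Multiplicative Γ →*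
      (Completion (H ⊗[ℂ] ConjSpace H) ≃ₗᵢ[ℂ] Completion (H ⊗[ℂ] ConjSpace H)) :=
  completionRep (tensorConjRep U)

theorem conjTensorRep_apply (U : Multiplicative Γ →* (H ≃ₗᵢ[ℂ] H)) (g : Multiplicative Γ)
    (a b : H) : conjTensorRep U g (conjTensor a b) = conjTensor (U g a) (U g b) := by
  rw [conjTensorRep, conjTensor, completionRep_coe, tensorConjRep_tmul, conjTensor]

/-- The projection of `a ⊗ ā` to the invariant vectors. -/
noncomputable def invTensor (U : Multiplicative Γ →* (H ≃ₗᵢ[ℂ] H)) (a : H) :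
    Completion (H ⊗[ℂ] ConjSpace H) :=
  (invSubspace (conjTensorRep U)).starProjection (conjTensor a a)

/-- The sesquilinear form `(v, w) ↦ ⟨P(a ⊗ ā), w ⊗ v̄⟩`. -/
noncomputable def avgForm (U : Multiplicative Γ →* (H ≃ₗᵢ[ℂ] H)) (a : H) :
    H →L⋆[ℂ] H →L[ℂ] ℂ :=
  LinearMap.mkContinuous₂
    (LinearMap.mk₂'ₛₗ (starRingEnd ℂ) (RingHom.id ℂ)
      (fun v w => inner ℂ (invTensor U a) (conjTensor w v))
      (fun v v' w => by rw [conjTensor_add_right, inner_add_right])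
      (fun c v w => by rw [conjTensor_smul_right, inner_smul_right]; rfl)
      (fun v w w' => by rw [conjTensor_add_left, inner_add_right])
      (fun c v w => by rw [conjTensor_smul_left, inner_smul_right]; rfl))
    ‖invTensor U a‖ (fun v w => by
      refine (norm_inner_le_norm (𝕜 := ℂ) (invTensor U a) (conjTensor w v)).trans ?_
      rw [norm_conjTensor, mul_comm ‖w‖, mul_assoc])

theorem avgForm_apply (U : Multiplicative Γ →* (H ≃ₗᵢ[ℂ] H)) (a v w : H) :
    avgForm U a v w = inner ℂ (invTensor U a) (conjTensor w v) := rfl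

/-- The product of two matrix coefficients `⟨U_γ a, w⟩ ⟨v, U_γ a⟩`. -/
noncomputable def coeffProd (U : Multiplicative Γ →* (H ≃ₗᵢ[ℂ] H)) (a v w : H) : LInf Γ :=
  star (matrixCoeff U v a) * matrixCoeff U w a

theorem coeffProd_apply (U : Multiplicative Γ →* (H ≃ₗᵢ[ℂ] H)) (a v w : H) (γ : Γ) :
    coeffProd U a v w γ = inner ℂ (U (Multiplicative.ofAdd γ) a) w *
      inner ℂ v (U (Multiplicative.ofAdd γ) a) := by
  rw [coeffProd, LInf.mul_apply, LInf.star_apply, matrixCoeff_apply, matrixCoeff_apply,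
    inner_conj_symm, mul_comm]

theorem coeffProd_self_apply (U : Multiplicative Γ →* (H ≃ₗᵢ[ℂ] H)) (a v : H) (γ : Γ) :
    coeffProd U a v v γ = ((‖inner ℂ v (U (Multiplicative.ofAdd γ) a)‖ ^ 2 : ℝ) : ℂ) := by
  rw [coeffProd_apply, ← inner_conj_symm, Complex.conj_mul']
  simp

variable [CompleteSpace H]

/-- The average of the rank one operators `(U_γ a) ⊗ (U_γ a)*`. -/
noncomputable def avgOp (U : Multiplicative Γ →* (H ≃ₗᵢ[ℂ] H)) (a : H) : H →L[ℂ] H :=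
  InnerProductSpace.continuousLinearMapOfBilin (avgForm U a)

theorem inner_avgOp (U : Multiplicative Γ →* (H ≃ₗᵢ[ℂ] H)) (a v w : H) :
    inner ℂ (avgOp U a v) w = inner ℂ (invTensor U a) (conjTensor w v) := by
  rw [avgOp, InnerProductSpace.continuousLinearMapOfBilin_apply, avgForm_apply]

/-- The operator is built from the invariant tensor `P(a ⊗ ā)`, so its form does not change when
both arguments are moved by `U g`. -/
theorem avgOp_comm (U : Multiplicative Γ →* (H ≃ₗᵢ[ℂ] H)) (a : H) (g : Multiplicative Γ) (v : H) :
    avgOp U a (U g v) = U g (avgOp U a v) := by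
  refine ext_inner_right ℂ fun w => ?_
  obtain ⟨w, rfl⟩ := (U g).surjective w
  rw [LinearIsometryEquiv.inner_map_map, inner_avgOp, inner_avgOp, ← conjTensorRep_apply]
  exact inner_rep_right_of_mem_invSubspace (Submodule.starProjection_apply_mem _ _) g.toAdd _

variable {η : LInf Γ →ₗ[ℂ] ℂ}

/-- A product of a coefficient of `U` and a conjugated one is a single coefficient of `U ⊗ Ū`, to
which the FS property applies. -/
theorem inner_avgOp_eq_mean (hη : η ∈ fsMeans Γ) (U : Multiplicative Γ →* (H ≃ₗᵢ[ℂ] H))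
    (a v w : H) : inner ℂ (avgOp U a v) w = η (coeffProd U a v w) := by
  have : coeffProd U a v w =
      matrixCoeff (conjTensorRep U) (conjTensor w v) (conjTensor a a) := LInf.ext fun γ => by
    rw [coeffProd_apply, matrixCoeff_apply, conjTensorRep_apply, inner_conjTensor]
  rw [this, hη.2, inner_avgOp, invTensor]

theorem avgOp_isSymmetric (hη : η ∈ fsMeans Γ) (U : Multiplicative Γ →* (H ≃ₗᵢ[ℂ] H)) (a : H) :
    (avgOp U a).toLinearMap.IsSymmetric := fun v w => by
  change inner ℂ (avgOp U a v) w = inner ℂ v (avgOp U a w)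
  rw [← inner_conj_symm v, inner_avgOp_eq_mean hη, inner_avgOp_eq_mean hη, ← hη.1.map_star]
  congr 1
  refine LInf.ext fun γ => ?_
  rw [LInf.star_apply, coeffProd_apply, coeffProd_apply, map_mul, inner_conj_symm,
    inner_conj_symm, mul_comm]

theorem re_inner_avgOp_nonneg (hη : η ∈ fsMeans Γ) (U : Multiplicative Γ →* (H ≃ₗᵢ[ℂ] H))
    (a v : H) : 0 ≤ (inner ℂ (avgOp U a v) v).re := by
  rw [inner_avgOp_eq_mean hη]
  refine (Complex.le_def.1 (hη.1.nonneg _ fun γ => ?_)).1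
  rw [coeffProd_self_apply]
  exact Complex.zero_le_real.2 (sq_nonneg _)

/-- Bessel's inequality for `U_γ a` at each `γ`, averaged by `η`: this is the trace bound that makes
`avgOp` compact. -/
theorem sum_re_inner_avgOp_le (hη : η ∈ fsMeans Γ) (U : Multiplicative Γ →* (H ≃ₗᵢ[ℂ] H))
    (a : H) {n : ℕ} {e : Fin n → H} (he : Orthonormal ℂ e) :
    ∑ i, (inner ℂ (avgOp U a (e i)) (e i)).re ≤ ‖a‖ ^ 2 := by
  have h1 : η (∑ i, coeffProd U a (e i) (e i)) ≤ η (((‖a‖ ^ 2 : ℝ) : ℂ) • (1 : LInf Γ)) := by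
    refine hη.1.mono fun γ => ?_
    have h2 : (∑ i, coeffProd U a (e i) (e i) : LInf Γ) γ =
        ((∑ i, ‖inner ℂ (e i) (U (Multiplicative.ofAdd γ) a)‖ ^ 2 : ℝ) : ℂ) := by
      rw [lp.coeFn_sum, Finset.sum_apply, Complex.ofReal_sum]
      exact Finset.sum_congr rfl fun i _ => coeffProd_self_apply U a (e i) γ
    rw [h2, LInf.smul_apply, LInf.one_apply, mul_one, Complex.real_le_real]
    simpa using he.sum_inner_products_le (U (Multiplicative.ofAdd γ) a) (s := Finset.univ)
  rw [map_sum, map_smul, hη.1.map_one, smul_eq_mul, mul_one] at h1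
  have h3 := (Complex.le_def.1 h1).1
  rw [Complex.re_sum, Complex.ofReal_re] at h3
  simpa only [inner_avgOp_eq_mean hη] using h3

/-- A vector orthogonal to all joint eigenvectors is weakly mixing along an FS-mean. -/
theorem mean_norm_sq_coeff_eq_zero (hη : η ∈ fsMeans Γ) (U : Multiplicative Γ →* (H ≃ₗᵢ[ℂ] H))
    {a : H} (ha : ∀ (e : H) (χ : AddChar Γ Circle),
      (∀ γ : Γ, U (Multiplicative.ofAdd γ) e = (χ γ : ℂ) • e) → inner ℂ e a = 0) (w : H) :
    η (star (matrixCoeff U w a) * matrixCoeff U w a) = 0 := by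
  -- If this compact symmetric operator were nonzero, some eigenspace for a nonzero eigenvalue would
  -- be finite-dimensional and `U`-invariant, hence would contain a joint eigenvector `e`. But `e`
  -- is orthogonal to the whole orbit of `a`, so `⟨avgOp e, e⟩ = 0`.
  suffices h : avgOp U a = 0 by
    have := inner_avgOp_eq_mean hη U a w w
    rw [h] at this
    simpa [coeffProd] using this.symm
  have hsymm := avgOp_isSymmetric hη U a
  have hcpt := isCompactOperator_of_trace_le hsymm (re_inner_avgOp_nonneg hη U a) (‖a‖ ^ 2)
    fun n e he => sum_re_inner_avgOp_le hη U a he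
  refine (ContinuousLinearMap.eq_zero_of_forall_hasEigenvalue_eq_zero hcpt hsymm).1 fun μ hμ => ?_
  by_contra hμ0
  have := ContinuousLinearMap.finite_dimensional_eigenspace hcpt μ hμ0
  obtain ⟨e, heE, he0, he⟩ := exists_joint_eigenvector U _
    (End.eigenspace (avgOp U a).toLinearMap μ) le_rfl hμ fun g x hx => by
      rw [End.mem_eigenspace_iff] at hx ⊢
      change avgOp U a x = μ • x at hx
      change avgOp U a (U g x) = μ • U g x
      rw [avgOp_comm, hx, map_smul]
  obtain ⟨χ, hχ⟩ := exists_char_of_joint_eigenvector U he0 he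
  have h1 : avgOp U a e = μ • e := End.mem_eigenspace_iff.1 heE
  have h2 : η (coeffProd U a e e) = 0 := by
    have : coeffProd U a e e = 0 := LInf.ext fun γ => by
      have h3 : inner ℂ (U (Multiplicative.ofAdd γ) e) (U (Multiplicative.ofAdd γ) a) = 0 := by
        rw [LinearIsometryEquiv.inner_map_map, ha e χ hχ]
      rw [hχ, inner_smul_left, mul_eq_zero, or_iff_right
        ((map_ne_zero _).2 (χ γ).coe_ne_zero)] at h3
      rw [coeffProd_apply, h3, mul_zero]; rfl
    rw [this, map_zero]
  rw [← inner_avgOp_eq_mean hη, h1, inner_smul_left, mul_eq_zero, inner_self_eq_zero] at h2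
  exact h2.elim (fun h => hμ0 ((map_eq_zero _).1 h)) he0

end WeakMixing

/-! ### The Koopman representation of an invariant mean -/

section Koopman

variable {Γ : Type u} [AddCommGroup Γ]

@[simp] theorem translate_apply (γ : Γ) (f : LInf Γ) (x : Γ) : translate γ f x = f (x - γ) := rfl

variable {ν : LInf Γ →ₗ[ℂ] ℂ} (hν : ν ∈ invariantMeans Γ)

/-- Translation, as a unitary operator on the pre-Hilbert space of an invariant mean. -/
noncomputable def preKoopman (γ : Γ) : PreGNS ν hν.1 ≃ₗᵢ[ℂ] PreGNS ν hν.1 where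
  toFun f := PreGNS.of hν.1 (translate γ ((PreGNS.of hν.1).symm f))
  invFun f := PreGNS.of hν.1 (translate (-γ) ((PreGNS.of hν.1).symm f))
  left_inv f := by
    refine (PreGNS.of hν.1).symm.injective (LInf.ext fun x => ?_)
    simp
  right_inv f := by
    refine (PreGNS.of hν.1).symm.injective (LInf.ext fun x => ?_)
    simp
  map_add' f g := rfl
  map_smul' c f := rfl
  norm_map' f := by
    change √(ν (translate γ (star ((PreGNS.of hν.1).symm f) * (PreGNS.of hν.1).symm f))).re = _
    rw [hν.2]; rfl

theorem preKoopman_of (γ : Γ) (f : LInf Γ) :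
    preKoopman hν γ (PreGNS.of hν.1 f) = PreGNS.of hν.1 (translate γ f) := rfl

/-- The Koopman representation of `Γ` on `L²(ν)`. -/
noncomputable def koopman : Multiplicative Γ →* (GNS hν.1 ≃ₗᵢ[ℂ] GNS hν.1) :=
  completionRep
    { toFun := fun g => preKoopman hν g.toAdd
      map_one' := LinearIsometryEquiv.ext fun f =>
        (PreGNS.of hν.1).symm.injective (LInf.ext fun x => by
          obtain ⟨f, rfl⟩ := (PreGNS.of hν.1).surjective f
          simp [preKoopman_of])
      map_mul' := fun g h => LinearIsometryEquiv.ext fun f =>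
        (PreGNS.of hν.1).symm.injective (LInf.ext fun x => by
          obtain ⟨f, rfl⟩ := (PreGNS.of hν.1).surjective f
          simp [preKoopman_of, sub_sub]) }

theorem koopman_gnsVec (γ : Γ) (f : LInf Γ) :
    koopman hν (Multiplicative.ofAdd γ) (gnsVec hν.1 f) = gnsVec hν.1 (translate γ f) := by
  rw [gnsVec_eq, koopman, completionRep_coe]; rfl

theorem matrixCoeff_koopman (f g : LInf Γ) (γ : Γ) :
    matrixCoeff (koopman hν) (gnsVec hν.1 g) (gnsVec hν.1 f) γ = ν (star (translate γ f) * g) := by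
  rw [matrixCoeff_apply, koopman_gnsVec, inner_gnsVec]

theorem gnsVec_one_mem : gnsVec hν.1 1 ∈ invSubspace (koopman hν) := fun γ => by
  rw [koopman_gnsVec]
  exact congrArg _ (LInf.ext fun x => by simp)

/-- The functional `g ↦ ⟨P f, g⟩`, for the projection `P` to the invariant vectors. -/
noncomputable def invPart (f : LInf Γ) : LInf Γ →ₗ[ℂ] ℂ :=
  (innerSL ℂ ((invSubspace (koopman hν)).starProjection (gnsVec hν.1 f))).toLinearMap ∘ₗ
    gnsVec hν.1

theorem invPart_apply (f g : LInf Γ) : invPart hν f g =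
    inner ℂ ((invSubspace (koopman hν)).starProjection (gnsVec hν.1 f)) (gnsVec hν.1 g) := rfl

theorem invPart_translate (f g : LInf Γ) (γ : Γ) :
    invPart hν f (translate γ g) = invPart hν f g := by
  rw [invPart_apply, invPart_apply, ← koopman_gnsVec]
  exact inner_rep_right_of_mem_invSubspace (Submodule.starProjection_apply_mem _ _) γ _

variable {η : LInf Γ →ₗ[ℂ] ℂ}

theorem invPart_eq_mean (hη : η ∈ fsMeans Γ) (f g : LInf Γ) :
    invPart hν f g =
      η (matrixCoeff (koopman hν) (gnsVec hν.1 g) (gnsVec hν.1 f)) := by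
  rw [hη.2, invPart_apply]

/-- Positivity is invisible in the projection itself; it appears once `η` writes the functional as
an average of the correlations of `f` and `g`. -/
theorem invPart_nonneg (hη : η ∈ fsMeans Γ) {f g : LInf Γ} (hf : ∀ x, 0 ≤ f x)
    (hg : ∀ x, 0 ≤ g x) : 0 ≤ invPart hν f g := by
  rw [invPart_eq_mean hν hη]
  refine hη.1.nonneg _ fun γ => ?_
  rw [matrixCoeff_koopman]
  refine hν.1.nonneg _ fun x => ?_
  exact mul_nonneg (star_nonneg_iff.2 (hf _)) (hg _)

theorem invPart_one (f : LInf Γ) : invPart hν f 1 = conj (ν f) := by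
  rw [invPart_apply, Submodule.inner_starProjection_left_eq_right,
    Submodule.starProjection_eq_self_iff.2 (gnsVec_one_mem hν), inner_gnsVec, mul_one,
    hν.1.map_star]

theorem invPart_one_left (g : LInf Γ) : invPart hν 1 g = ν g := by
  rw [invPart_apply, Submodule.starProjection_eq_self_iff.2 (gnsVec_one_mem hν), inner_gnsVec]
  congr 1
  exact LInf.ext fun x => by simp

theorem invPart_sub_left (f f' g : LInf Γ) :
    invPart hν (f - f') g = invPart hν f g - invPart hν f' g := by
  simp only [invPart_apply, map_sub, inner_sub_left]

theorem smul_invPart_mem (hη : η ∈ fsMeans Γ) {f : LInf Γ} (hf : ∀ x, 0 ≤ f x)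
    {c : ℝ} (hc : 0 < c) (hcf : ν f = c) : (c⁻¹ : ℝ) • invPart hν f ∈ invariantMeans Γ := by
  refine ⟨⟨?_, fun g hg => ?_⟩, fun g γ => ?_⟩
  · rw [LinearMap.smul_apply, invPart_one, hcf, Complex.conj_ofReal, Complex.real_smul,
      ← Complex.ofReal_mul, inv_mul_cancel₀ hc.ne', Complex.ofReal_one]
  · rw [LinearMap.smul_apply, Complex.real_smul]
    exact mul_nonneg (Complex.zero_le_real.2 (by positivity)) (invPart_nonneg hν hη hf hg)
  · rw [LinearMap.smul_apply, LinearMap.smul_apply, invPart_translate]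

end Koopman

/-! ### Extreme invariant means are ergodic -/

section Ergodic

variable {Γ : Type u} [AddCommGroup Γ] {ν η : LInf Γ →ₗ[ℂ] ℂ}

/-- The normalized functionals of `f` and `1 - f` are invariant means whose convex combination with
weights `c` and `1 - c` is `ν`; extremality identifies the first with `ν`. -/
theorem invPart_eq_of_extreme (hν : ν ∈ extremeInvariantMeans Γ) (hη : η ∈ fsMeans Γ)
    {f : LInf Γ} (h0 : ∀ x, 0 ≤ f x) (h1 : ∀ x, f x ≤ 1) {c : ℝ} (hc : ν f = c)
    (hc0 : 0 < c) (hc1 : c < 1) : invPart hν.1 f = (c : ℂ) • ν := by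
  have hx := smul_invPart_mem hν.1 hη h0 hc0 hc
  have hy := smul_invPart_mem hν.1 hη (f := 1 - f) (fun x => sub_nonneg.2 (h1 x))
    (sub_pos.2 hc1) (by rw [map_sub, hν.1.1.map_one, hc]; simp)
  have := ((mem_extremePoints.1 hν).2 _ hx _ hy ⟨c, 1 - c, hc0, sub_pos.2 hc1, by ring, ?_⟩).1
  · refine LinearMap.ext fun g => ?_
    have h := LinearMap.congr_fun this g
    rw [LinearMap.smul_apply, ← h, LinearMap.smul_apply, Complex.real_smul, smul_eq_mul, ← mul_assoc, ← Complex.ofReal_mul, mul_inv_cancel₀ hc0.ne']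
    simp
  · rw [smul_smul, smul_smul, mul_inv_cancel₀ hc0.ne', mul_inv_cancel₀ (sub_pos.2 hc1).ne',
      one_smul, one_smul]
    refine LinearMap.ext fun g => ?_
    rw [LinearMap.add_apply, invPart_sub_left, invPart_one_left]
    ring

theorem starProjection_gnsVec (hν : ν ∈ extremeInvariantMeans Γ) (hη : η ∈ fsMeans Γ)
    (f : LInf Γ) : (invSubspace (koopman hν.1)).starProjection (gnsVec hν.1.1 f) =
      ν f • gnsVec hν.1.1 1 := by
  let S : Submodule ℂ (LInf Γ) := LinearMap.ker
    ((invSubspace (koopman hν.1)).starProjection.toLinearMap ∘ₗ gnsVec hν.1.1 -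
      ν.smulRight (gnsVec hν.1.1 1))
  have hS : ∀ f, f ∈ S ↔ (invSubspace (koopman hν.1)).starProjection (gnsVec hν.1.1 f) =
      ν f • gnsVec hν.1.1 1 := fun f => by
    simp [S, LinearMap.mem_ker, sub_eq_zero]
  have h_one : (1 : LInf Γ) ∈ S := by
    rw [hS, Submodule.starProjection_eq_self_iff.2 (gnsVec_one_mem hν.1), hν.1.1.map_one, one_smul]
  -- Values in `[1/4, 3/4]` force `0 < ν f < 1`, so both normalizations are legitimate. Scaling,
  -- adding constants and splitting into real and imaginary parts then reach every `f`.
  have h_mid : ∀ f : LInf Γ, (∀ x, (1 / 4 : ℂ) ≤ f x) → (∀ x, f x ≤ (3 / 4 : ℂ)) → f ∈ S := by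
    intro f hf hf'
    have q1 := hν.1.1.mono (f := (1 / 4 : ℂ) • (1 : LInf Γ)) (g := f)
      fun x => by simpa using hf x
    have q2 := hν.1.1.mono (f := f) (g := (3 / 4 : ℂ) • (1 : LInf Γ))
      fun x => by simpa using hf' x
    rw [map_smul, hν.1.1.map_one, smul_eq_mul, mul_one] at q1 q2
    rw [Complex.le_def] at q1 q2
    have hc : ν f = ((ν f).re : ℂ) := Complex.ext rfl (by rw [← q1.2]; simp)
    have hlow : (0 : ℂ) ≤ 1 / 4 := by
      rw [Complex.le_def]; constructor <;> norm_num
    have hhigh : (3 / 4 : ℂ) ≤ 1 := by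
      rw [Complex.le_def]; constructor <;> norm_num
    have key := invPart_eq_of_extreme hν hη (f := f) (fun x => hlow.trans (hf x))
      (fun x => (hf' x).trans hhigh) hc
      (by have := q1.1; norm_num at this; linarith) (by have := q2.1; norm_num at this; linarith)
    rw [hS]
    refine (denseRange_gnsVec hν.1.1).eq_of_inner_left ℂ fun g => ?_
    rw [← invPart_apply, key, inner_smul_left, inner_gnsVec, ← hc, hc, Complex.conj_ofReal,
      LinearMap.smul_apply, smul_eq_mul]
    congr 2
    exact LInf.ext fun x => by simp
  have h_real : ∀ f : LInf Γ, (∀ x, (f x).im = 0) → f ∈ S := by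
    intro f hf
    set r : ℝ := 4 * (‖f‖ + 1) with hr
    have hr0 : 0 < r := by positivity
    have hb : ∀ x, |(f x).re / r| ≤ 1 / 4 := fun x => by
      rw [abs_div, abs_of_pos hr0, div_le_iff₀ hr0]
      have := (Complex.abs_re_le_norm (f x)).trans (LInf.norm_apply_le f x)
      rw [hr]; linarith
    have happ : ∀ x, ((1 / 2 : ℂ) • (1 : LInf Γ) + ((r⁻¹ : ℝ) : ℂ) • f) x =
        ((1 / 2 + (f x).re / r : ℝ) : ℂ) := fun x => by
      rw [LInf.add_apply, LInf.smul_apply, LInf.smul_apply, LInf.one_apply]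
      have : f x = ((f x).re : ℂ) := Complex.ext rfl (by simp [hf x])
      rw [this]; push_cast; rw [Complex.ofReal_re]; ring
    have := h_mid ((1 / 2 : ℂ) • (1 : LInf Γ) + ((r⁻¹ : ℝ) : ℂ) • f)
      (fun x => by
        rw [happ x]
        have : (1 / 4 : ℂ) = ((1 / 4 : ℝ) : ℂ) := by norm_num
        rw [this, Complex.real_le_real]
        linarith [(abs_le.1 (hb x)).1])
      (fun x => by
        rw [happ x]
        have : (3 / 4 : ℂ) = ((3 / 4 : ℝ) : ℂ) := by norm_num
        rw [this, Complex.real_le_real]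
        linarith [(abs_le.1 (hb x)).2])
    have h2 := (Submodule.add_mem_iff_right S (S.smul_mem (1 / 2 : ℂ) h_one)).1 this
    exact (Submodule.smul_mem_iff S (by
      exact_mod_cast (inv_pos.2 hr0).ne')).1 h2
  rw [← hS]
  have hdec : f = (1 / 2 : ℂ) • (f + star f) + (-Complex.I / 2) • (Complex.I • (f - star f)) := by
    refine LInf.ext fun x => ?_
    simp only [LInf.add_apply, LInf.smul_apply, LInf.sub_apply, LInf.star_apply]
    linear_combination ((1 / 2) * (f x - conj (f x))) * Complex.I_mul_I
  rw [hdec]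
  refine S.add_mem (S.smul_mem _ (h_real _ fun x => ?_)) (S.smul_mem _ (h_real _ fun x => ?_))
  · simp
  · simp

theorem mean_matrixCoeff_koopman (hν : ν ∈ extremeInvariantMeans Γ) (hη : η ∈ fsMeans Γ)
    (f g : LInf Γ) :
    η (matrixCoeff (koopman hν.1) (gnsVec hν.1.1 g) (gnsVec hν.1.1 f)) = conj (ν f) * ν g := by
  rw [hη.2, starProjection_gnsVec hν hη, inner_smul_left, inner_gnsVec]
  congr 2
  exact LInf.ext fun x => by simp

end Ergodic

/-! ### Fourier analysis in `L²(ν)` and `L²(η)` -/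

section Characters

variable {Γ : Type u} [AddCommGroup Γ]

/-- A character, as an element of `ℓ^∞(Γ)`. -/
noncomputable def charFn (χ : AddChar Γ Circle) : LInf Γ :=
  mkLInf (fun x => (χ x : ℂ)) 1 (fun x => (Circle.norm_coe (χ x)).le)

@[simp] theorem charFn_apply (χ : AddChar Γ Circle) (x : Γ) : charFn χ x = (χ x : ℂ) := rfl

theorem norm_charFn_le (χ : AddChar Γ Circle) : ‖charFn χ‖ ≤ 1 :=
  norm_mkLInf_le _ _ zero_le_one

@[simp] theorem star_charFn (χ : AddChar Γ Circle) : star (charFn χ) = charFn χ⁻¹ :=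
  LInf.ext fun x => by
    rw [LInf.star_apply, charFn_apply, charFn_apply, AddChar.inv_apply', Circle.coe_inv_eq_conj]

theorem charFn_mul (χ ψ : AddChar Γ Circle) : charFn χ * charFn ψ = charFn (χ * ψ) :=
  LInf.ext fun x => by simp

theorem charFn_one : charFn (1 : AddChar Γ Circle) = 1 :=
  LInf.ext fun x => by simp

theorem translate_charFn (χ : AddChar Γ Circle) (γ : Γ) :
    translate γ (charFn χ) = ((χ⁻¹ γ : Circle) : ℂ) • charFn χ :=
  LInf.ext fun x => by
    simp [sub_eq_add_neg, AddChar.map_add_eq_mul, AddChar.inv_apply, mul_comm]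

variable {ν η : LInf Γ →ₗ[ℂ] ℂ}

theorem map_charFn_eq_zero (hν : ν ∈ invariantMeans Γ) {χ : AddChar Γ Circle} (hχ : χ ≠ 1) :
    ν (charFn χ) = 0 := by
  obtain ⟨γ, hγ⟩ := AddChar.ne_one_iff.1 (inv_ne_one.2 hχ)
  have h := hν.2 (charFn χ) γ
  rw [translate_charFn, map_smul, smul_eq_mul] at h
  by_contra h0
  exact hγ (Circle.ext (by simpa using mul_right_cancel₀ h0 (h.trans (one_mul _).symm)))

/-- The coefficient `γ ↦ ⟨χ, U_γ χ⟩` in `L²(ν)` is `χ` itself. This makes characters orthonormal in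
`L²(η)` although `η` is not assumed invariant. -/
theorem fs_charFn_eq_zero (hν : ν ∈ extremeInvariantMeans Γ) (hη : η ∈ fsMeans Γ)
    {χ : AddChar Γ Circle} (hχ : χ ≠ 1) : η (charFn χ) = 0 := by
  have h := mean_matrixCoeff_koopman hν hη (charFn χ) (charFn χ)
  rw [map_charFn_eq_zero hν.1 hχ, mul_zero] at h
  rw [← h]
  congr 1
  refine LInf.ext fun γ => ?_
  rw [matrixCoeff_koopman, translate_charFn, star_smul, smul_mul_assoc, map_smul, star_charFn,
    charFn_mul, inv_mul_cancel, charFn_one, hν.1.1.map_one, charFn_apply, AddChar.inv_apply',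
    Circle.coe_inv_eq_conj]
  simp

theorem orthonormal_charFn (hν : IsMean ν) (h : ∀ χ : AddChar Γ Circle, χ ≠ 1 → ν (charFn χ) = 0) :
    Orthonormal ℂ fun χ : AddChar Γ Circle => gnsVec hν (charFn χ) := by
  classical
  rw [orthonormal_iff_ite]
  intro χ ψ
  rw [inner_gnsVec, star_charFn, charFn_mul]
  split_ifs with hχ
  · rw [hχ, inv_mul_cancel, charFn_one, hν.map_one]
  · exact h _ fun h1 => hχ (inv_mul_eq_one.1 h1)

/-- Multiplication by `χ` turns the twisted representation into the Koopman one, so ergodicity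
transfers: the eigenspace of each character is the line of one character function. The inverse
appears because translation by `γ` multiplies `ψ` by `ψ(-γ)`. -/
theorem starProjection_twist_koopman (hν : ν ∈ extremeInvariantMeans Γ) (hη : η ∈ fsMeans Γ)
    (χ : AddChar Γ Circle) (v : GNS hν.1.1) :
    (invSubspace (twist χ⁻¹ (koopman hν.1))).starProjection v =
      inner ℂ (gnsVec hν.1.1 (charFn χ⁻¹)) v • gnsVec hν.1.1 (charFn χ⁻¹) := by
  have hcont : Continuous fun v : GNS hν.1.1 =>
      inner ℂ (gnsVec hν.1.1 (charFn χ⁻¹)) v • gnsVec hν.1.1 (charFn χ⁻¹) := by fun_prop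
  refine congrFun ((denseRange_gnsVec hν.1.1).equalizer (ContinuousLinearMap.continuous _)
    hcont (funext fun f => ?_)) v
  refine (denseRange_gnsVec hν.1.1).eq_of_inner_left ℂ fun g => ?_
  rw [Function.comp_apply, Function.comp_apply, ← hη.2, inner_smul_left, inner_gnsVec,
    inner_gnsVec, star_charFn, inv_inv,
    ← mean_matrixCoeff_koopman hν hη (charFn χ * f) (charFn χ * g)]
  congr 1
  refine LInf.ext fun γ => ?_
  rw [matrixCoeff_koopman, matrixCoeff_apply, twist_apply, koopman_gnsVec, inner_smul_left,
    inner_gnsVec, ← smul_eq_mul, ← map_smul]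
  congr 1
  refine LInf.ext fun x => ?_
  have h : ((χ x : ℂ)) * conj (χ x : ℂ) = 1 := by
    rw [Complex.mul_conj]; simp
  have h2 : χ (x - γ) = χ x * (χ γ)⁻¹ := by
    rw [sub_eq_add_neg, AddChar.map_add_eq_mul, AddChar.map_neg_eq_inv]
  simp only [LInf.smul_apply, LInf.mul_apply, LInf.star_apply, translate_apply, charFn_apply,
    map_mul, h2, Circle.coe_mul, AddChar.inv_apply', Circle.coe_inv_eq_conj, Complex.conj_conj]
  linear_combination -(conj (f (x - γ)) * g x * (χ γ : ℂ)) * h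

theorem inner_eigenvector_eq_zero (hν : ν ∈ extremeInvariantMeans Γ) (hη : η ∈ fsMeans Γ)
    {a : GNS hν.1.1} (ha : ∀ χ : AddChar Γ Circle, inner ℂ (gnsVec hν.1.1 (charFn χ)) a = 0)
    (e : GNS hν.1.1) (χ : AddChar Γ Circle)
    (he : ∀ γ : Γ, koopman hν.1 (Multiplicative.ofAdd γ) e = (χ γ : ℂ) • e) :
    inner ℂ e a = 0 := by
  have hmem : e ∈ invSubspace (twist χ⁻¹ (koopman hν.1)) := fun γ => by
    rw [twist_apply, he, smul_smul, AddChar.inv_apply', ← Circle.coe_mul, inv_mul_cancel]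
    simp
  have h := starProjection_twist_koopman hν hη χ e
  rw [Submodule.starProjection_eq_self_iff.2 hmem] at h
  rw [h, inner_smul_left, ha, mul_zero]

/-- The functional `v ↦ η(γ ↦ b(γ) ⟨w, U_γ v⟩)` on `L²(ν)`. -/
noncomputable def weightedAvg (hη : IsMean η) (hν : ν ∈ invariantMeans Γ) (b : LInf Γ)
    (w : GNS hν.1) : GNS hν.1 →L[ℂ] ℂ :=
  LinearMap.mkContinuous
    { toFun := fun v => η (b * star (matrixCoeff (koopman hν) w v))
      map_add' := fun v v' => by
        rw [← map_add]
        congr 1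
        refine LInf.ext fun γ => ?_
        simp only [LInf.mul_apply, LInf.add_apply, LInf.star_apply, matrixCoeff_apply, map_add,
          inner_add_left]
        ring
      map_smul' := fun c v => by
        rw [RingHom.id_apply, ← map_smul]
        congr 1
        refine LInf.ext fun γ => ?_
        simp only [LInf.mul_apply, LInf.smul_apply, LInf.star_apply, matrixCoeff_apply, map_smul,
          inner_smul_left, map_mul, Complex.conj_conj]
        ring }
    (‖b‖ * ‖w‖) (fun v => by
      refine (hη.norm_le _).trans ((norm_mul_le _ _).trans ?_)
      rw [norm_star, mul_assoc, mul_comm ‖w‖]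
      gcongr
      exact norm_mkLInf_le _ _ (by positivity))

theorem weightedAvg_apply (hη : IsMean η) (hν : ν ∈ invariantMeans Γ) (b : LInf Γ)
    (w v : GNS hν.1) :
    weightedAvg hη hν b w v = η (b * star (matrixCoeff (koopman hν) w v)) := rfl

/-- Cauchy–Schwarz for `η` separates the weight `b` from the mean square of the coefficient, which
is zero by weak mixing. -/
theorem weightedAvg_eq_zero (hν : ν ∈ extremeInvariantMeans Γ) (hη : η ∈ fsMeans Γ)
    {a : GNS hν.1.1} (ha : ∀ χ : AddChar Γ Circle, inner ℂ (gnsVec hν.1.1 (charFn χ)) a = 0)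
    (b : LInf Γ) (w : GNS hν.1.1) : weightedAvg hη.1 hν.1 b w a = 0 := by
  have h := hη.1.norm_sq_le b (star (matrixCoeff (koopman hν.1) w a))
  rw [star_star, mul_comm (matrixCoeff (koopman hν.1) w a), mean_norm_sq_coeff_eq_zero hη _
    (inner_eigenvector_eq_zero hν hη ha) w, Complex.zero_re, mul_zero] at h
  exact norm_eq_zero.1 (pow_eq_zero_iff two_ne_zero |>.1 (le_antisymm h (sq_nonneg _)))

theorem weightedAvg_charFn (hν : ν ∈ invariantMeans Γ) (hη : IsMean η) (χ : AddChar Γ Circle)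
    (b : LInf Γ) (w : GNS hν.1) : weightedAvg hη hν b w (gnsVec hν.1 (charFn χ)) =
      inner ℂ (gnsVec hη (charFn χ)) (gnsVec hη b) * inner ℂ w (gnsVec hν.1 (charFn χ)) := by
  rw [weightedAvg_apply, inner_gnsVec, star_charFn, mul_comm (η _), ← smul_eq_mul (inner ℂ w _), ← map_smul]
  congr 1
  refine LInf.ext fun γ => ?_
  rw [LInf.mul_apply, LInf.star_apply, matrixCoeff_apply, inner_conj_symm, koopman_gnsVec,
    translate_charFn, map_smul, inner_smul_right, LInf.smul_apply, LInf.mul_apply, charFn_apply]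
  ring

/-- The average of translates of `f` weighted by `b` is an absolutely convergent series of
characters. -/
theorem exists_charSeries (hν : ν ∈ extremeInvariantMeans Γ) (hη : η ∈ fsMeans Γ)
    (f b : LInf Γ) : ∃ (k : AddChar Γ Circle → ℂ) (h : LInf Γ), Summable (fun χ => ‖k χ‖) ∧
      (∀ x, HasSum (fun χ => k χ * (χ x : ℂ)) (h x)) ∧
      ∀ g, η (b * star (matrixCoeff (koopman hν.1) (gnsVec hν.1.1 g) (gnsVec hν.1.1 f))) =
        ν (star g * h) := by
  have hoν := orthonormal_charFn hν.1.1 fun χ hχ => map_charFn_eq_zero hν.1 hχ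
  have hoη := orthonormal_charFn hη.1 fun χ hχ => fs_charFn_eq_zero hν hη hχ
  set c : AddChar Γ Circle → ℂ := fun χ => inner ℂ (gnsVec hν.1.1 (charFn χ)) (gnsVec hν.1.1 f)
    with hc
  set d : AddChar Γ Circle → ℂ := fun χ => inner ℂ (gnsVec hη.1 (charFn χ)) (gnsVec hη.1 b)
    with hd
  have hcs : Summable fun χ => ‖c χ‖ ^ 2 := hoν.inner_products_summable (gnsVec hν.1.1 f)
  have hds : Summable fun χ => ‖d χ‖ ^ 2 := hoη.inner_products_summable (gnsVec hη.1 b)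
  have hks : Summable fun χ => ‖c χ * d χ‖ := by
    refine Summable.of_nonneg_of_le (fun χ => norm_nonneg _) (fun χ => ?_) (hcs.add hds)
    rw [norm_mul]
    nlinarith [sq_nonneg (‖c χ‖ - ‖d χ‖), sq_nonneg ‖c χ‖, sq_nonneg ‖d χ‖]
  have hhs : Summable fun χ => (c χ * d χ) • charFn χ := by
    refine Summable.of_norm_bounded hks fun χ => ?_
    rw [norm_smul]
    exact mul_le_of_le_one_right (norm_nonneg _) (norm_charFn_le χ)
  have hps : Summable fun χ => c χ • gnsVec hν.1.1 (charFn χ) := by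
    have := (hoν.orthogonalFamily.summable_iff_norm_sq_summable c).2 hcs
    simpa using this
  obtain ⟨p, hp⟩ := hps
  obtain ⟨h, hh⟩ := hhs
  refine ⟨fun χ => c χ * d χ, h, hks, fun x => ?_, fun g => ?_⟩
  · let ev : LInf Γ →L[ℂ] ℂ := LinearMap.mkContinuous
      { toFun := fun f => f x, map_add' := fun _ _ => rfl, map_smul' := fun _ _ => rfl } 1
      fun f => (LInf.norm_apply_le f x).trans (one_mul _).ge
    exact hh.mapL ev
  -- `p` is the projection of `f` to the closed span of the characters; the remainder is killed by
  -- every weighted average, and on `p` the average is computed term by term.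
  · have hperp : ∀ χ, inner ℂ (gnsVec hν.1.1 (charFn χ)) (gnsVec hν.1.1 f - p) = 0 := fun χ => by
      classical
      have h1 := hp.mapL (innerSL ℂ (gnsVec hν.1.1 (charFn χ)))
      have h2 : HasSum (fun ψ => innerSL ℂ (gnsVec hν.1.1 (charFn χ))
          (c ψ • gnsVec hν.1.1 (charFn ψ))) (c χ) := by
        convert hasSum_ite_eq χ (c χ) using 2 with ψ
        rw [innerSL_apply_apply, inner_smul_right, orthonormal_iff_ite.1 hoν]
        by_cases hψ : ψ = χ
        · simp [hψ]
        · simp [hψ, Ne.symm hψ]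
      rw [inner_sub_right, sub_eq_zero]
      exact h2.unique h1
    have h0 := weightedAvg_eq_zero hν hη hperp b (gnsVec hν.1.1 g)
    rw [map_sub, sub_eq_zero] at h0
    rw [← weightedAvg_apply hη.1 hν.1, h0]
    have h1 := hp.mapL (weightedAvg hη.1 hν.1 b (gnsVec hν.1.1 g))
    have h2 := hh.mapL (hν.1.1.toCLM ∘L ContinuousLinearMap.mul ℂ (LInf Γ) (star g))
    refine h1.unique (h2.congr_fun fun χ => ?_)
    rw [map_smul, weightedAvg_charFn, inner_gnsVec hν.1.1 g, ContinuousLinearMap.comp_apply,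
      ContinuousLinearMap.mul_apply', IsMean.toCLM_apply, mul_smul_comm, map_smul, smul_eq_mul,
      smul_eq_mul, mul_assoc]

end Characters

/-! ### Existence of extreme invariant means charging a set -/

section KreinMilman

variable {Γ : Type u} [AddCommGroup Γ]

/-- Tychonoff: the defining conditions are closed under pointwise convergence, and `‖m f‖ ≤ ‖f‖`
confines means to a product of discs. -/
theorem isCompact_invariantMeans :
    IsCompact ((fun m : LInf Γ →ₗ[ℂ] ℂ => (m : LInf Γ → ℂ)) '' invariantMeans Γ) := by
  refine (isCompact_univ_pi fun f : LInf Γ => isCompact_closedBall (0 : ℂ) ‖f‖).of_isClosed_subset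
    ?_ ?_
  · have : (fun m : LInf Γ →ₗ[ℂ] ℂ => (m : LInf Γ → ℂ)) '' invariantMeans Γ =
        {φ | ∀ f g, φ (f + g) = φ f + φ g} ∩ {φ | ∀ (c : ℂ) f, φ (c • f) = c * φ f} ∩
        {φ | φ 1 = 1} ∩ {φ | ∀ f : LInf Γ, (∀ x, 0 ≤ f x) → 0 ≤ φ f} ∩
        {φ | ∀ f γ, φ (translate γ f) = φ f} := by
      ext φ
      constructor
      · rintro ⟨m, hm, rfl⟩
        exact ⟨⟨⟨⟨map_add m, map_smul m⟩, hm.1.map_one⟩, hm.1.nonneg⟩, hm.2⟩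
      · rintro ⟨⟨⟨⟨h1, h2⟩, h3⟩, h4⟩, h5⟩
        exact ⟨{ toFun := φ, map_add' := h1, map_smul' := h2 }, ⟨⟨h3, h4⟩, h5⟩, rfl⟩
    rw [this]
    simp only [Set.ofPred_forall]
    refine (((IsClosed.inter ?_ ?_).inter ?_).inter ?_).inter ?_
    · exact isClosed_iInter fun f => isClosed_iInter fun g =>
        isClosed_eq (continuous_apply _) ((continuous_apply f).add (continuous_apply g))
    · exact isClosed_iInter fun c => isClosed_iInter fun f =>
        isClosed_eq (continuous_apply _) (continuous_const.mul (continuous_apply _))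
    · exact isClosed_eq (continuous_apply _) continuous_const
    · exact isClosed_iInter fun f => isClosed_iInter fun hf =>
        isClosed_le continuous_const (continuous_apply _)
    · exact isClosed_iInter fun f => isClosed_iInter fun γ =>
        isClosed_eq (continuous_apply _) (continuous_apply _)
  · rintro _ ⟨m, hm, rfl⟩ f -
    exact mem_closedBall_zero_iff.2 (hm.1.norm_le f)

/-- The maximizers of `φ ↦ Re φ(1_A)` form a nonempty compact exposed face, and an extreme point of
a face is extreme in the whole set. -/
theorem exists_extreme_meas_ge {m : LInf Γ →ₗ[ℂ] ℂ} (hm : m ∈ invariantMeans Γ) (A : Set Γ) :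
    ∃ ν ∈ extremeInvariantMeans Γ, meas m A ≤ meas ν A := by
  set K := (fun m : LInf Γ →ₗ[ℂ] ℂ => (m : LInf Γ → ℂ)) '' invariantMeans Γ with hK
  let l : (LInf Γ → ℂ) →L[ℝ] ℝ :=
    Complex.reCLM ∘L (ContinuousLinearMap.proj (R := ℝ) (φ := fun _ : LInf Γ => ℂ) (ind A))
  have hl : ∀ φ, l φ = (φ (ind A)).re := fun φ => rfl
  set F := {φ ∈ K | ∀ ψ ∈ K, l ψ ≤ l φ} with hF
  have hexp : IsExposed ℝ K F := fun _ => ⟨l, rfl⟩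
  obtain ⟨φ₀, hφ₀, hmax⟩ := isCompact_invariantMeans.exists_isMaxOn ⟨_, m, hm, rfl⟩
    l.continuous.continuousOn
  have hFne : F.Nonempty := ⟨φ₀, hφ₀, hmax⟩
  obtain ⟨φ, hφ⟩ := (hexp.isCompact isCompact_invariantMeans).extremePoints_nonempty hFne
  have hφK := hexp.isExtreme.extremePoints_subset_extremePoints hφ
  obtain ⟨ν, hν, rfl⟩ := hφK.1
  refine ⟨ν, ⟨hν, fun x₁ h₁ x₂ h₂ hx => ?_⟩, hφ.1.2 _ ⟨m, hm, rfl⟩⟩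
  refine DFunLike.coe_injective (hφK.2 ⟨x₁, h₁, rfl⟩ ⟨x₂, h₂, rfl⟩ ?_)
  obtain ⟨a, b, ha, hb, hab, rfl⟩ := hx
  exact ⟨a, b, ha, hb, hab, rfl⟩

theorem exists_extreme_meas_pos {A : Set Γ} (hA : 0 < upperBanachDensity A) :
    ∃ ν ∈ extremeInvariantMeans Γ, 0 < meas ν A := by
  by_contra! h
  refine hA.not_ge (Real.sSup_nonpos ?_)
  rintro _ ⟨m, hm, rfl⟩
  obtain ⟨ν, hν, hle⟩ := exists_extreme_meas_ge hm A
  exact hle.trans (h ν hν)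

end KreinMilman

/-! ### Bohr neighborhoods -/

section BohrTopology

variable {Γ : Type u} [AddCommGroup Γ]

instance : CompactSpace (Additive Circle) := inferInstanceAs (CompactSpace Circle)

theorem denseRange_bohrEmbedding : DenseRange (bohrEmbedding : Γ → BohrCompactification Γ) := by
  refine Subtype.dense_iff.2 ?_
  rw [← Set.range_comp]
  exact subset_rfl

instance : CompactSpace (BohrCompactification Γ) :=
  isCompact_iff_compactSpace.1 (AddSubgroup.isClosed_topologicalClosure _).isCompact

/-- By density of `Γ`, its translates of the open set cover the Bohr compactification; compactness
leaves finitely many. -/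
theorem IsBohrNhd.isSyndetic {U : Set Γ} (hU : IsBohrNhd U) : IsSyndetic U := by
  obtain ⟨γ₀, V, hV, hγ₀, hVU⟩ := hU
  obtain ⟨t, ht⟩ := isCompact_univ.elim_finite_subcover
    (fun γ : Γ => {z : BohrCompactification Γ | z - bohrEmbedding γ ∈ V})
    (fun γ => hV.preimage (continuous_id.sub continuous_const)) (fun z _ => by
      have ho : IsOpen {y : BohrCompactification Γ | z - y ∈ V} :=
        hV.preimage (continuous_const.sub continuous_id)
      obtain ⟨γ, hγ⟩ := denseRange_bohrEmbedding.exists_mem_open ho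
        ⟨z - bohrEmbedding γ₀, by simpa using hγ₀⟩
      exact Set.mem_iUnion.2 ⟨γ, hγ⟩)
  refine ⟨t, t.finite_toSet, Set.eq_univ_of_forall fun x => ?_⟩
  obtain ⟨γ, hγ, hx⟩ := Set.mem_iUnion₂.1 (ht (Set.mem_univ (bohrEmbedding x)))
  refine Set.mem_add.2 ⟨x - γ, hVU ?_, γ, hγ, sub_add_cancel x γ⟩
  rw [Set.mem_preimage, map_sub]
  exact hx

/-- Characters are coordinates on the Bohr compactification, so by the Weierstrass test an
absolutely convergent series extends continuously there. -/
theorem isBohrNhd_of_charSeries {k : AddChar Γ Circle → ℂ} (hk : Summable fun χ => ‖k χ‖)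
    {h : Γ → ℂ} (hh : ∀ x, HasSum (fun χ => k χ * (χ x : ℂ)) (h x)) {ε : ℝ}
    (hne : ∃ x, ε < (h x).re) : IsBohrNhd {x | ε < (h x).re} := by
  obtain ⟨γ₀, hγ₀⟩ := hne
  let F : BohrCompactification Γ → ℂ := fun z => ∑' χ, k χ * ((z.1 χ).toMul : ℂ)
  have hF : Continuous F := by
    refine continuous_tsum (fun χ => ?_) hk fun χ z => ?_
    · exact continuous_const.mul (continuous_subtype_val.comp
        (continuous_toMul.comp ((continuous_apply χ).comp continuous_subtype_val)))
    · rw [norm_mul, Circle.norm_coe, mul_one]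
  have hFe : ∀ x, F (bohrEmbedding x) = h x := fun x => (hh x).tsum_eq
  refine ⟨γ₀, {z | ε < (F z).re}, isOpen_lt continuous_const (Complex.continuous_re.comp hF), ?_,
    fun x hx => ?_⟩
  · change ε < (F _).re
    rwa [hFe]
  · change ε < (F _).re at hx
    rwa [hFe] at hx

end BohrTopology

/-! ### Sumsets and thickness -/

section Sumset

variable {Γ : Type u} [AddCommGroup Γ] {ν η : LInf Γ →ₗ[ℂ] ℂ}

theorem IsMean.re_mono {X : Type u} {m : LInf X →ₗ[ℂ] ℂ} (hm : IsMean m) {f g : LInf X}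
    (h : ∀ x, (f x).re ≤ (g x).re) : (m f).re ≤ (m g).re := by
  have := hm.mono (f := f + star f) (g := g + star g) fun x => by
    rw [LInf.add_apply, LInf.add_apply, LInf.star_apply, LInf.star_apply, Complex.add_conj,
      Complex.add_conj, Complex.real_le_real]
    linarith [h x]
  rw [map_add, map_add, hm.map_star, hm.map_star, Complex.add_conj, Complex.add_conj,
    Complex.real_le_real] at this
  linarith

theorem translate_ind_mul_ind {A B : Set Γ} {γ : Γ} (hγ : γ ∈ B) {D : Set Γ}
    (hD : Disjoint D (A + B)) : translate γ (ind A) * ind D = 0 := by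
  refine LInf.ext fun x => ?_
  rw [LInf.mul_apply, translate_apply]
  by_cases hx : x ∈ D
  · rw [ind_apply_notMem, zero_mul]
    · rfl
    · exact fun hA => Set.disjoint_left.1 hD hx
        (Set.mem_add.2 ⟨x - γ, hA, γ, hγ, sub_add_cancel x γ⟩)
  · rw [ind_apply_notMem hx, mul_zero]; rfl

theorem star_translate_ind (A : Set Γ) (γ : Γ) :
    star (translate γ (ind A)) = translate γ (ind A) :=
  LInf.ext fun x => congrArg (fun f : LInf Γ => f (x - γ)) (star_ind A)

theorem exists_bohrNhd_essSubset (hν : ν ∈ extremeInvariantMeans Γ) (hη : η ∈ fsMeans Γ)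
    {A B : Set Γ} (hA : 0 < meas ν A) (hB : 0 < meas η B) :
    ∃ U : Set Γ, IsBohrNhd U ∧ EssSubset ν U (A + B) := by
  obtain ⟨k, h, hk, hh, hg⟩ := exists_charSeries hν hη (ind A) (ind B)
  set ε : ℝ := meas ν A * meas η B / 2 with hε
  have hε0 : 0 < ε := by positivity
  have hνh : ν h = ((meas ν A * meas η B : ℝ) : ℂ) := by
    have h1 := hg 1
    have h2 : star (1 : LInf Γ) * h = h := LInf.ext fun x => by simp
    rw [h2] at h1
    rw [← h1, Complex.ofReal_mul, ← hη.1.map_ind, ← smul_eq_mul (meas ν A : ℂ), ← map_smul]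
    congr 1
    refine LInf.ext fun γ => ?_
    have h3 : star (translate γ (ind A)) * 1 = translate γ (ind A) := by
      rw [mul_one, star_translate_ind]
    rw [LInf.mul_apply, LInf.star_apply, matrixCoeff_koopman, h3, hν.1.2, hν.1.1.map_ind,
      Complex.conj_ofReal, LInf.smul_apply, mul_comm]
  refine ⟨{x | ε < (h x).re}, isBohrNhd_of_charSeries hk hh ?_, ?_⟩
  -- `ν(h) = 2ε` exceeds `ε`, so `Re h` cannot stay at or below `ε`.
  · by_contra! hle
    have := hν.1.1.re_mono (f := h) (g := (ε : ℂ) • (1 : LInf Γ)) fun x => by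
      rw [LInf.smul_apply, LInf.one_apply, mul_one, Complex.ofReal_re]
      exact hle x
    rw [map_smul, hν.1.1.map_one, smul_eq_mul, mul_one, Complex.ofReal_re, hνh,
      Complex.ofReal_re] at this
    linarith
  · set D := {x | ε < (h x).re} \ (A + B) with hD
    have h1 := hg (ind D)
    -- For `γ ∈ B` the translate `A + γ` lies in `A + B` and misses `D`. So `ν(1_D h) = 0`, while
    -- `Re h > ε` on `D`.
    have h2 : ind B * star (matrixCoeff (koopman hν.1) (gnsVec hν.1.1 (ind D))
        (gnsVec hν.1.1 (ind A))) = 0 := by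
      refine LInf.ext fun γ => ?_
      by_cases hγ : γ ∈ B
      · rw [LInf.mul_apply, LInf.star_apply, matrixCoeff_koopman, star_translate_ind,
          translate_ind_mul_ind hγ Set.disjoint_sdiff_left, map_zero, map_zero, mul_zero]
        rfl
      · rw [LInf.mul_apply, ind_apply_notMem hγ, zero_mul]; rfl
    rw [h2, map_zero, star_ind] at h1
    have h3 := hν.1.1.re_mono (f := (ε : ℂ) • ind D) (g := ind D * h) fun x => by
      by_cases hx : x ∈ D
      · rw [LInf.smul_apply, LInf.mul_apply, ind_apply_mem hx, mul_one, one_mul, Complex.ofReal_re]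
        exact le_of_lt hx.1
      · rw [LInf.smul_apply, LInf.mul_apply, ind_apply_notMem hx, mul_zero, zero_mul]
    rw [← h1, map_smul, hν.1.1.map_ind, smul_eq_mul, ← Complex.ofReal_mul, Complex.ofReal_re,
      Complex.zero_re] at h3
    exact le_antisymm (nonpos_of_mul_nonpos_right h3 hε0) (hν.1.1.meas_nonneg _)

theorem meas_add_eq_one (hν : ν ∈ extremeInvariantMeans Γ) (hη : η ∈ fsMeans Γ)
    {A B : Set Γ} (h : 1 < meas ν A + meas η B) : meas ν (A + B) = 1 := by
  set C := (A + B)ᶜ with hC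
  have h1 := mean_matrixCoeff_koopman hν hη (ind A) (ind C)
  rw [hν.1.1.map_ind, hν.1.1.map_ind, Complex.conj_ofReal] at h1
  -- The correlation of `A` and `C` is zero on `B` and at most `ν(C)` elsewhere; averaging gives
  -- `ν(A) ν(C) ≤ ν(C) (1 - η(B))`.
  have h2 := hη.1.mono (f := matrixCoeff (koopman hν.1) (gnsVec hν.1.1 (ind C))
    (gnsVec hν.1.1 (ind A))) (g := (meas ν C : ℂ) • ind Bᶜ) fun γ => by
      rw [matrixCoeff_koopman, star_translate_ind, LInf.smul_apply]
      by_cases hγ : γ ∈ B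
      · rw [translate_ind_mul_ind hγ disjoint_compl_left, map_zero, ind_apply_notMem, mul_zero]
        exact fun h => h hγ
      · rw [ind_apply_mem (show γ ∈ Bᶜ from hγ), mul_one, ← hν.1.1.map_ind]
        refine hν.1.1.mono fun x => ?_
        rw [LInf.mul_apply, translate_apply]
        by_cases hx : x - γ ∈ A <;> by_cases hx' : x ∈ C <;> simp [hx, hx']
  rw [h1, map_smul, hη.1.map_ind, smul_eq_mul, ← Complex.ofReal_mul, ← Complex.ofReal_mul,
    Complex.real_le_real, hη.1.meas_compl] at h2
  have h3 := hν.1.1.meas_nonneg C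
  have h4 := hν.1.1.meas_compl (A + B)
  rw [← hC] at h4
  nlinarith

theorem isThick_of_meas_eq_one (hν : ν ∈ invariantMeans Γ) {T : Set Γ} (hT : meas ν T = 1) :
    IsThick T := by
  intro F hF
  by_contra! hcon
  -- The bad shifts for `G` form a finite union of translates of the null set `Tᶜ`. If no shift
  -- worked for `F`, they would fill `Γ`.
  have h1 : ∀ G : Set Γ, G.Finite → meas ν {t | ∃ f ∈ G, f + t ∉ T} = 0 := by
    intro G hG
    induction G, hG using Set.Finite.induction_on with
    | empty =>
      refine le_antisymm ?_ (hν.1.meas_nonneg _)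
      have : ind {t : Γ | ∃ f ∈ (∅ : Set Γ), f + t ∉ T} = 0 := LInf.ext fun x => by simp
      rw [meas, this, map_zero, Complex.zero_re]
    | @insert a s _ _ ih =>
      have h2 : {t | ∃ f ∈ insert a s, f + t ∉ T} =
          {t | a + t ∉ T} ∪ {t | ∃ f ∈ s, f + t ∉ T} := by
        ext t; simp
      have h3 : meas ν {t | a + t ∉ T} = 0 := by
        have : ind {t | a + t ∉ T} = translate (-a) (ind Tᶜ) := LInf.ext fun x => by
          rw [translate_apply, sub_neg_eq_add, add_comm x]
          by_cases hx : a + x ∈ T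
          · rw [ind_apply_notMem (A := Tᶜ) (fun h => h hx),
              ind_apply_notMem (A := {t | a + t ∉ T}) (fun h => h hx)]
          · rw [ind_apply_mem (A := Tᶜ) hx, ind_apply_mem (A := {t | a + t ∉ T}) hx]
        rw [meas, this, hν.2]
        change meas ν Tᶜ = 0
        rw [hν.1.meas_compl, hT, sub_self]
      refine le_antisymm ?_ (hν.1.meas_nonneg _)
      rw [h2]
      linarith [hν.1.meas_union_le {t | a + t ∉ T} {t | ∃ f ∈ s, f + t ∉ T}]
  have h4 : {t | ∃ f ∈ F, f + t ∉ T} = T ∪ Tᶜ := by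
    rw [Set.union_compl_self]
    refine Set.eq_univ_of_forall fun t => ?_
    obtain ⟨_, hx, hxT⟩ := Set.not_subset.1 (hcon t)
    obtain ⟨f, hf, _, rfl, rfl⟩ := Set.mem_add.1 hx
    exact ⟨f, hf, hxT⟩
  have h5 := h1 F hF
  rw [h4] at h5
  linarith [hν.1.meas_mono (Set.subset_union_left : T ⊆ T ∪ Tᶜ)]

end Sumset

end SumsetMeans

theorem corollary4p2 {Γ : Type u} [AddCommGroup Γ] (A B : Set Γ) :
    (0 < upperBanachDensity A → (∃ η ∈ fsMeans Γ, 0 < meas η B) →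
      IsPiecewiseBohr (A + B) ∧ IsPiecewiseSyndetic (A + B) ∧
        ∀ ν ∈ extremeInvariantMeans Γ, 0 < meas ν A →
          ∃ U : Set Γ, IsBohrNhd U ∧ EssSubset ν U (A + B)) ∧
    (∀ ν ∈ extremeInvariantMeans Γ, ∀ η ∈ fsMeans Γ, 1 < meas ν A + meas η B →
      meas ν (A + B) = 1 ∧ IsThick (A + B)) := by
  refine ⟨fun hA ⟨η, hη, hB⟩ => ?_, fun ν hν η hη h => ?_⟩
  · obtain ⟨ν, hν, hνA⟩ := exists_extreme_meas_pos hA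
    obtain ⟨U, hU, hUs⟩ := exists_bohrNhd_essSubset hν hη hνA hB
    exact ⟨⟨ν, hν.1, U, hU, hUs⟩, ⟨ν, hν.1, U, hU.isSyndetic, hUs⟩,
      fun ν' hν' hA' => exists_bohrNhd_essSubset hν' hη hA' hB⟩
  · have h1 := meas_add_eq_one hν hη h
    exact ⟨h1, isThick_of_meas_eq_one hν.1 h1⟩
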